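/- **Setting.** Let $\mathcal X$ be a measurable space, endowed with an arbitrary total ordering, and let $(\boldsymbol x_1,\boldsymbol y_1),\dots,(\boldsymbol x_N,\boldsymbol y_N)$, $N\ge 1$, be i.i.d. random elements of $\mathcal X\times\mathbb R$ with common law $D$. Let $\varphi:\mathcal X\to\mathcal H$ be a feature map into a real Hilbert space (with $(x,x')\mapsto\langle\varphi(x),\varphi(x')\rangle$ jointly measurable), let $\varrho>0$ and let $t\ge 0$ (the prediction tolerance). All multisets are finite; $\cup$ adds multiplicities and $|U|$ counts elements with multiplicity. **Support Vector Regression.** For a multiset $S$ of examples $(x_1,y_1),\dots,(x_n,y_n)$, $n\ge 0$, let $(w^*(S),b^*(S))\in\mathcal H\times\mathbb R$ be the solution of $$\min_{w\in\mathcal H,\ b\in\mathbb R,\ \xi_i\ge 0}\ \|w\|^2+\varrho\sum_{i=1}^n\xi_i\quad\text{subject to}\quad |y_i-\langle w,\varphi(x_i)\rangle-b|\le t+\xi_i,\quad i=1,\dots,n,$$ where, if $b$ is not unique, the minimizer with the smallest $|b|$ is taken (this determines $(w^*(S),b^*(S))$ uniquely). Put $\mathcal A_{\mathrm{SVR}}(S)(x)=\langle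 w^*(S),\varphi(x)\rangle+b^*(S)$. The risk of a predictor $h:\mathcal X\to\mathbb R$ is $\mathsf R(h)=D\{(x,y): |y-h(x)|>t\}$. **Compression.** Let $\mathsf c_{\mathrm{SVR}}(S)=S_+\cup S_0$, where $S_+$ is the multiset of all examples of $S$ (with their multiplicities) for which $|y_i-\mathcal A_{\mathrm{SVR}}(S)(x_i)|>t$, and $S_0$ is a sub-multiset of $S$ of smallest cardinality among those that contain only examples with $|y_i-\mathcal A_{\mathrm{SVR}}(S)(x_i)|=t$ and satisfy $w^*(S_+\cup S_0)=w^*(S)$, $b^*(S_+\cup S_0)=b^*(S)$. If there are several, the one whose increasingly ordered list of instances $x_i$ is lexicographically smallest is taken (remaining ties, between multisets with the same instances, are broken by comparing lexicographically the lists of examples ordered by instance and then by label). **Bounds.** For $\delta\in(0,1)$, $0\le k\le N$ and $\alpha<1$ let $$\tilde\Psi_{k,\delta}(\alpha)=\frac{\delta}{2N}\sum_{m=k}^{N-1}\frac{\binom mk}{\binom Nk}(1-\alpha)^{-(N-m)}+\frac{\delta}{6N}\sum_{m=N+1}^{4N}\frac{\binom mk}{\binom Nk}(1-\alpha)^{m-N},$$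 where the first sum is empty for $k=N$. In $(-\infty,1)$ the equation $\tilde\Psi_{k,\delta}(\alpha)=1$ has exactly two solutions $\underline\alpha_k<\overline\alpha_k$ if $k<N$, and exactly one solution $\underline\alpha_N$ if $k=N$. Put $\underline\epsilon_k=\max\{0,\underline\alpha_k\}$ for $0\le k\le N$, $\overline\epsilon_k=\overline\alpha_k$ for $k<N$, and $\overline\epsilon_N=1$. **Theorem.** Assume that, almost surely, the regular conditional distribution of $\boldsymbol y$ given $\boldsymbol x$ under $D$ has no concentrated mass (no atoms). Then, for every $\delta\in(0,1)$, with $\boldsymbol S$ the multiset of $(\boldsymbol x_1,\boldsymbol y_1),\dots,(\boldsymbol x_N,\boldsymbol y_N)$ and $\boldsymbol k=|\mathsf c_{\mathrm{SVR}}(\boldsymbol S)|$, $$\Pr\big\{\underline\epsilon_{\boldsymbol k}\le \mathsf R(\mathcal A_{\mathrm{SVR}}(\boldsymbol S))\le\overline\epsilon_{\boldsymbol k}\big\}\ge 1-\delta .$$ -/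

import Mathlib

open MeasureTheory ProbabilityTheory

namespace SVR

noncomputable section

/-- The function `Ψ̃_{k,δ}` for sample size `N`. For `k = N` the first sum is empty and
`N.choose N = 1`, so only `(δ / 6N) ∑_{m=N+1}^{4N} (m choose N) (1 - α)^(m-N)` is left.
Both natural-number subtractions are of the smaller number from the larger one. -/
def psiTilde (N : ℕ) (δ : ℝ) (k : ℕ) (α : ℝ) : ℝ :=
  δ / (2 * N) * ∑ m ∈ Finset.Ico k N,
      (m.choose k : ℝ) / (N.choose k : ℝ) * ((1 - α) ^ (N - m))⁻¹ +
  δ / (6 * N) * ∑ m ∈ Finset.Icc (N + 1) (4 * N),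
      (m.choose k : ℝ) / (N.choose k : ℝ) * (1 - α) ^ (m - N)

/-- The solutions in `(-∞, 1)` of `Ψ̃_{k,δ}(α) = 1`: exactly two for `k < N`, exactly one for
`k = N`. -/
def psiTildeRoots (N : ℕ) (δ : ℝ) (k : ℕ) : Set ℝ :=
  {α | α < 1 ∧ psiTilde N δ k α = 1}

/-- The lower bound `max {0, α_k}`, with `α_k` the smallest (for `k = N`: the only) solution. -/
def epsLower (N : ℕ) (δ : ℝ) (k : ℕ) : ℝ :=
  max 0 (sInf (psiTildeRoots N δ k))

/-- The upper bound: the largest solution for `k < N`, and `1` for `k = N`. -/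
def epsUpper (N : ℕ) (δ : ℝ) (k : ℕ) : ℝ :=
  if k < N then sSup (psiTildeRoots N δ k) else 1

variable {X H : Type*} [NormedAddCommGroup H] [InnerProductSpace ℝ H]

/-- The affine predictor `x ↦ ⟨w, φ x⟩ + b` with parameters `p = (w, b)`. -/
def predictor (φ : X → H) (p : H × ℝ) (x : X) : ℝ :=
  inner ℝ p.1 (φ x) + p.2

/-- Feasibility in the training program for the multiset `S` of examples. The slack variables are
a multiset `Ξ` of pairs (example, slack) whose examples are those of `S`, with repetitions. -/
def Feasible (φ : X → H) (t : ℝ) (S : Multiset (X × ℝ)) (p : H × ℝ)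
    (Ξ : Multiset ((X × ℝ) × ℝ)) : Prop :=
  Ξ.map Prod.fst = S ∧ ∀ q ∈ Ξ, 0 ≤ q.2 ∧ |q.1.2 - predictor φ p q.1.1| ≤ t + q.2

/-- The objective `‖w‖² + ρ ∑ ξ_i`. -/
def objective (ρ : ℝ) (p : H × ℝ) (Ξ : Multiset ((X × ℝ) × ℝ)) : ℝ :=
  ‖p.1‖ ^ 2 + ρ * (Ξ.map Prod.snd).sum

/-- `(w, b)` together with the slacks `Ξ` solves the training program. -/
def IsMinimizer (φ : X → H) (ρ t : ℝ) (S : Multiset (X × ℝ)) (p : H × ℝ)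
    (Ξ : Multiset ((X × ℝ) × ℝ)) : Prop :=
  Feasible φ t S p Ξ ∧
    ∀ (p' : H × ℝ) (Ξ' : Multiset ((X × ℝ) × ℝ)),
      Feasible φ t S p' Ξ' → objective ρ p Ξ ≤ objective ρ p' Ξ'

/-- `(w, b)` is optimal, and `|b|` is smallest among all the optimal solutions. -/
def IsSolution (φ : X → H) (ρ t : ℝ) (S : Multiset (X × ℝ)) (p : H × ℝ) : Prop :=
  (∃ Ξ, IsMinimizer φ ρ t S p Ξ) ∧
    ∀ (p' : H × ℝ) (Ξ' : Multiset ((X × ℝ) × ℝ)), IsMinimizer φ ρ t S p' Ξ' → |p.2| ≤ |p'.2|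

/-- The pair `(w*(S), b*(S))`: the solution exists and is unique for every `S` when `0 < ρ`. -/
def solution (φ : X → H) (ρ t : ℝ) (S : Multiset (X × ℝ)) : H × ℝ :=
  Classical.epsilon (IsSolution φ ρ t S)

/-- The learning algorithm: the predictor returned by support vector regression on `S`. -/
def algorithm (φ : X → H) (ρ t : ℝ) (S : Multiset (X × ℝ)) : X → ℝ :=
  predictor φ (solution φ ρ t S)

/-- The statistical risk of a predictor `h`: the probability, for an example `(x, y)` with law
`D`, that `|y - h x| > t`. -/
def risk [MeasurableSpace X] (D : Measure (X × ℝ)) (t : ℝ) (h : X → ℝ) : ℝ :=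
  D.real {z | t < |z.2 - h z.1|}

open Classical in
/-- `S₊`: all the examples of `S`, with repetitions, whose residual exceeds `t`. -/
def violated (φ : X → H) (ρ t : ℝ) (S : Multiset (X × ℝ)) : Multiset (X × ℝ) :=
  S.filter fun z => t < |z.2 - algorithm φ ρ t S z.1|

/-- `T` is a sub-multiset of examples of `S` with residual exactly `t`, such that `S₊ ∪ T` gives
the same solution as `S`. (The union of multisets adds multiplicities.) -/
def IsCandidate (φ : X → H) (ρ t : ℝ) (S T : Multiset (X × ℝ)) : Prop :=
  T ≤ S ∧ (∀ z ∈ T, |z.2 - algorithm φ ρ t S z.1| = t) ∧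
    solution φ ρ t (violated φ ρ t S + T) = solution φ ρ t S

/-- `T` is a candidate of smallest cardinality. -/
def IsSmallestCandidate (φ : X → H) (ρ t : ℝ) (S T : Multiset (X × ℝ)) : Prop :=
  IsCandidate φ ρ t S T ∧ ∀ T', IsCandidate φ ρ t S T' → T.card ≤ T'.card

/-- The key for breaking ties: the increasing list of the instances, compared lexicographically;
if two multisets have the same instances, the increasing list of the examples (by instance and
then by label) decides. -/
def tieKey [LinearOrder X] (T : Multiset (X × ℝ)) : List X ×ₗ List (X ×ₗ ℝ) :=
  toLex ((T.map Prod.fst).sort (· ≤ ·), (T.map toLex).sort (· ≤ ·))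

/-- `T` is, among the candidates of smallest cardinality, the first one in the tie order. -/
def IsSelected [LinearOrder X] (φ : X → H) (ρ t : ℝ) (S T : Multiset (X × ℝ)) : Prop :=
  IsSmallestCandidate φ ρ t S T ∧
    ∀ T', IsSmallestCandidate φ ρ t S T' → tieKey T ≤ tieKey T'

/-- `S₀`: the selected candidate, which exists and is unique. -/
def support [LinearOrder X] (φ : X → H) (ρ t : ℝ) (S : Multiset (X × ℝ)) : Multiset (X × ℝ) :=
  Classical.epsilon (IsSelected φ ρ t S)

/-- The compression function `c(S) = S₊ ∪ S₀`. -/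
def compression [LinearOrder X] (φ : X → H) (ρ t : ℝ) (S : Multiset (X × ℝ)) :
    Multiset (X × ℝ) :=
  violated φ ρ t S + support φ ρ t S

/-- The training set: the multiset of the observed examples `z_1, …, z_N`. -/
def trainingSet {N : ℕ} (z : Fin N → X × ℝ) : Multiset (X × ℝ) :=
  Finset.univ.val.map z

end

end SVR

/-! Call an example active if its residual under the predictor trained on the whole sample is at
least `t`. By convexity, examples strictly inside the tube can be removed, and examples inside or on
the tube can be added, without changing the solution. Hence `K` is the active set exactly when
training on `K` alone makes all of `K` active and every other example falls strictly inside the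
resulting tube (`active_eq_iff`).

Let `s` be the probability that a fresh example falls strictly inside the tube, and let `ν k` be the
law of `s` for samples of size `k`, restricted to the event that all examples are active. By Fubini,
a sample of size `m` has `k` active examples and inside probability in `ds` with mass `(m choose k)
s^(m-k) dν k` (`lintegral_active`). The measures `ν k` do not depend on `m`, so total mass one gives
a moment identity for every `m`.

The failure probability at size `N` is a linear functional of the `ν k`, and it is bounded by weak
linear programming duality. Outside the interval between the bounds `psiTilde` is at least `1`, so
the failure density is dominated by a combination of the densities for sizes `m ≠ N`, with weights
`δ/(2N)` for `m < N` and `δ/(6N)` for `N < m ≤ 4N`. These weights add up to `δ`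
(`sum_lintegral_compl_le`).

The absence of atoms enters twice: almost surely the compression has as many elements as the active
set (`card_compression_eq`), and the risk is `1 - s` (`risk_eq`). -/

namespace SVR

/-! ### Convex analysis of the training program. -/

section Deterministic

open Filter Topology

variable {X H : Type*} [NormedAddCommGroup H] [InnerProductSpace ℝ H]

/-- The smallest slack that makes the example `z` feasible for the parameters `p`. -/
noncomputable def loss (φ : X → H) (t : ℝ) (p : H × ℝ) (z : X × ℝ) : ℝ :=
  max 0 (|z.2 - predictor φ p z.1| - t)

/-- The training objective after elimination of the slacks. -/
noncomputable def cost (φ : X → H) (ρ t : ℝ) (S : Multiset (X × ℝ)) (p : H × ℝ) : ℝ :=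
  ‖p.1‖ ^ 2 + ρ * (S.map (loss φ t p)).sum

variable {φ : X → H} {ρ t : ℝ} {S R : Multiset (X × ℝ)} {p p' : H × ℝ}

lemma loss_nonneg (z : X × ℝ) : 0 ≤ loss φ t p z := le_max_left _ _

lemma loss_eq_zero {z : X × ℝ} (h : |z.2 - predictor φ p z.1| ≤ t) : loss φ t p z = 0 :=
  max_eq_left (by linarith)

lemma sum_loss_nonneg : 0 ≤ (S.map (loss φ t p)).sum :=
  Multiset.sum_nonneg fun _ hx => by
    obtain ⟨z, -, rfl⟩ := Multiset.mem_map.1 hx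
    exact loss_nonneg z

lemma cost_nonneg (hρ : 0 < ρ) : 0 ≤ cost φ ρ t S p :=
  add_nonneg (sq_nonneg _) (mul_nonneg hρ.le sum_loss_nonneg)

lemma cost_add : cost φ ρ t (S + R) p = cost φ ρ t S p + ρ * (R.map (loss φ t p)).sum := by
  simp only [cost, Multiset.map_add, Multiset.sum_add]
  ring

lemma cost_le_cost_add (hρ : 0 < ρ) : cost φ ρ t S p ≤ cost φ ρ t (S + R) p := by
  rw [cost_add]
  exact le_add_of_nonneg_right (mul_nonneg hρ.le sum_loss_nonneg)

lemma cost_add_of_residual_le (h : ∀ z ∈ R, |z.2 - predictor φ p z.1| ≤ t) :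
    cost φ ρ t (S + R) p = cost φ ρ t S p := by
  rw [cost_add, Multiset.map_congr rfl fun z hz => loss_eq_zero (h z hz)]
  simp

lemma cost_le_objective (hρ : 0 < ρ) {Ξ : Multiset ((X × ℝ) × ℝ)} (h : Feasible φ t S p Ξ) :
    cost φ ρ t S p ≤ objective ρ p Ξ := by
  obtain ⟨rfl, h⟩ := h
  unfold cost objective
  gcongr
  rw [Multiset.map_map]
  refine Multiset.sum_map_le_sum_map _ _ fun q hq => max_le (h q hq).1 ?_
  linarith [(h q hq).2]

lemma feasible_loss : Feasible φ t S p (S.map fun z => (z, loss φ t p z)) := by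
  refine ⟨by simp, fun q hq => ?_⟩
  obtain ⟨z, -, rfl⟩ := Multiset.mem_map.1 hq
  refine ⟨loss_nonneg z, ?_⟩
  have : |z.2 - predictor φ p z.1| - t ≤ loss φ t p z := le_max_right _ _
  dsimp only
  linarith

lemma objective_loss : objective ρ p (S.map fun z => (z, loss φ t p z)) = cost φ ρ t S p := by
  simp [objective, cost, Multiset.map_map]

lemma exists_isMinimizer_iff (hρ : 0 < ρ) :
    (∃ Ξ, IsMinimizer φ ρ t S p Ξ) ↔ ∀ p', cost φ ρ t S p ≤ cost φ ρ t S p' := by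
  constructor
  · rintro ⟨Ξ, hΞ, h⟩ p'
    exact (cost_le_objective hρ hΞ).trans ((h p' _ feasible_loss).trans_eq objective_loss)
  · intro h
    refine ⟨_, feasible_loss, fun p' Ξ' h' => ?_⟩
    rw [objective_loss]
    exact (h p').trans (cost_le_objective hρ h')

lemma isSolution_iff (hρ : 0 < ρ) : IsSolution φ ρ t S p ↔
    (∀ p', cost φ ρ t S p ≤ cost φ ρ t S p') ∧
      ∀ p', (∀ p'', cost φ ρ t S p' ≤ cost φ ρ t S p'') → |p.2| ≤ |p'.2| := by
  simp only [← exists_isMinimizer_iff hρ, forall_exists_index]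
  rfl

lemma predictor_combo (a b : ℝ) (x : X) :
    predictor φ (a • p + b • p') x = a * predictor φ p x + b * predictor φ p' x := by
  simp only [predictor, Prod.fst_add, Prod.smul_fst, Prod.snd_add, Prod.smul_snd, inner_add_left,
    real_inner_smul_left, smul_eq_mul]
  ring

lemma residual_combo_le {a b : ℝ} (ha : 0 ≤ a) (hb : 0 ≤ b) (hab : a + b = 1) (z : X × ℝ) :
    |z.2 - predictor φ (a • p + b • p') z.1| ≤
      a * |z.2 - predictor φ p z.1| + b * |z.2 - predictor φ p' z.1| := by
  have : z.2 - predictor φ (a • p + b • p') z.1 =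
      a * (z.2 - predictor φ p z.1) + b * (z.2 - predictor φ p' z.1) := by
    rw [predictor_combo]
    linear_combination -z.2 * hab
  rw [this]
  refine (abs_add_le _ _).trans_eq ?_
  rw [abs_mul, abs_mul, abs_of_nonneg ha, abs_of_nonneg hb]

lemma loss_combo_le {a b : ℝ} (ha : 0 ≤ a) (hb : 0 ≤ b) (hab : a + b = 1) (z : X × ℝ) :
    loss φ t (a • p + b • p') z ≤ a * loss φ t p z + b * loss φ t p' z := by
  refine max_le (add_nonneg (mul_nonneg ha (loss_nonneg z)) (mul_nonneg hb (loss_nonneg z))) ?_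
  have h1 : |z.2 - predictor φ p z.1| - t ≤ loss φ t p z := le_max_right _ _
  have h2 : |z.2 - predictor φ p' z.1| - t ≤ loss φ t p' z := le_max_right _ _
  have h3 := residual_combo_le (φ := φ) (p := p) (p' := p') ha hb hab z
  have h4 := mul_le_mul_of_nonneg_left h1 ha
  have h5 := mul_le_mul_of_nonneg_left h2 hb
  linear_combination h3 + h4 + h5 + t * hab

/-- The squared norm makes the cost strongly convex in the weight; in the offset it is merely
convex, which is why a tie-break on the offset is needed. -/
lemma cost_combo_le (hρ : 0 < ρ) {a b : ℝ} (ha : 0 ≤ a) (hb : 0 ≤ b) (hab : a + b = 1) :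
    cost φ ρ t S (a • p + b • p') ≤
      a * cost φ ρ t S p + b * cost φ ρ t S p' - a * b * ‖p.1 - p'.1‖ ^ 2 := by
  have h1 : (S.map (loss φ t (a • p + b • p'))).sum ≤
      a * (S.map (loss φ t p)).sum + b * (S.map (loss φ t p')).sum := by
    rw [← Multiset.sum_map_mul_left, ← Multiset.sum_map_mul_left, ← Multiset.sum_map_add]
    exact Multiset.sum_map_le_sum_map _ _ fun z _ => loss_combo_le ha hb hab z
  have h2 : ‖(a • p + b • p').1‖ ^ 2 =
      a * ‖p.1‖ ^ 2 + b * ‖p'.1‖ ^ 2 - a * b * ‖p.1 - p'.1‖ ^ 2 := by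
    obtain rfl : b = 1 - a := by linarith
    rw [Prod.fst_add, Prod.smul_fst, Prod.smul_fst, norm_add_sq_real, norm_sub_sq_real, norm_smul,
      norm_smul, real_inner_smul_left, real_inner_smul_right, mul_pow, mul_pow, Real.norm_eq_abs,
      Real.norm_eq_abs, sq_abs, sq_abs]
    ring
  unfold cost
  rw [h2]
  linear_combination ρ * h1

lemma norm_sub_sq_le_of_isMin (hρ : 0 < ρ) (h : ∀ p', cost φ ρ t S p ≤ cost φ ρ t S p') :
    ‖p'.1 - p.1‖ ^ 2 ≤ 2 * (cost φ ρ t S p' - cost φ ρ t S p) := by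
  have h1 := cost_combo_le (φ := φ) (t := t) (S := S) (p := p') (p' := p) hρ
    (a := 1 / 2) (b := 1 / 2) (by norm_num) (by norm_num) (by norm_num)
  linarith [h ((1 / 2 : ℝ) • p' + (1 / 2 : ℝ) • p)]

lemma IsSolution.unique (hρ : 0 < ρ) (h : IsSolution φ ρ t S p) (h' : IsSolution φ ρ t S p') :
    p = p' := by
  rw [isSolution_iff hρ] at h h'
  have hv : cost φ ρ t S p = cost φ ρ t S p' := le_antisymm (h.1 _) (h'.1 _)
  have hw : p'.1 = p.1 := by
    have := norm_sub_sq_le_of_isMin (p' := p') hρ h.1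
    rw [hv, sub_self, mul_zero] at this
    exact sub_eq_zero.1 (norm_eq_zero.1 (pow_eq_zero_iff two_ne_zero |>.1
      (le_antisymm this (sq_nonneg _))))
  have hb : |p.2| = |p'.2| := le_antisymm (h.2 _ h'.1) (h'.2 _ h.1)
  refine Prod.ext hw.symm ?_
  rcases abs_eq_abs.1 hb with hb | hb
  · exact hb
  -- With opposite offsets, the midpoint would be a minimizer with offset `0`, so both offsets
  -- vanish.
  · have hm := cost_combo_le (φ := φ) (t := t) (S := S) (p := p) (p' := p') hρ
      (a := 1 / 2) (b := 1 / 2) (by norm_num) (by norm_num) (by norm_num)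
    have h0 := h.2 ((1 / 2 : ℝ) • p + (1 / 2 : ℝ) • p') fun p'' => by
      have := h.1 p''
      have := sq_nonneg ‖p.1 - p'.1‖
      linarith
    have h1 : ((1 / 2 : ℝ) • p + (1 / 2 : ℝ) • p').2 = 0 := by
      simp [hb]
    rw [h1, abs_zero] at h0
    have : p.2 = 0 := abs_eq_zero.1 (le_antisymm h0 (abs_nonneg _))
    linarith

lemma continuous_predictor (x : X) : Continuous fun p : H × ℝ => predictor φ p x := by
  unfold predictor
  fun_prop

lemma continuous_cost : Continuous (cost φ ρ t S) := by
  unfold cost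
  refine (by fun_prop : Continuous fun p : H × ℝ => ‖p.1‖ ^ 2).add (continuous_const.mul ?_)
  refine continuous_multiset_sum (f := fun z p => loss φ t p z) S fun z _ => ?_
  have := continuous_predictor (φ := φ) z.1
  unfold loss
  fun_prop

/-- The new examples cost nothing at `p` and at least nothing elsewhere; any minimizer for the
larger sample therefore also minimizes for the smaller one, which settles the tie-break. -/
lemma IsSolution.add (hρ : 0 < ρ) (h : IsSolution φ ρ t S p)
    (hR : ∀ z ∈ R, |z.2 - predictor φ p z.1| ≤ t) : IsSolution φ ρ t (S + R) p := by
  rw [isSolution_iff hρ] at h ⊢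
  have h0 := cost_add_of_residual_le (ρ := ρ) (S := S) hR
  refine ⟨fun p' => ?_, fun p' hp' => h.2 p' fun p'' => ?_⟩
  · rw [h0]
    exact (h.1 p').trans (cost_le_cost_add hρ)
  · exact (cost_le_cost_add hρ).trans ((hp' p).trans (h0.le.trans (h.1 p'')))

lemma eventually_residual_combo_le (hR : ∀ z ∈ R, |z.2 - predictor φ p z.1| < t) (p' : H × ℝ) :
    ∀ᶠ θ in 𝓝 (0 : ℝ), ∀ z ∈ R, |z.2 - predictor φ ((1 - θ) • p + θ • p') z.1| ≤ t := by
  classical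
  have : ∀ᶠ θ in 𝓝 (0 : ℝ), ∀ z ∈ R.toFinset,
      |z.2 - predictor φ ((1 - θ) • p + θ • p') z.1| < t := by
    rw [Filter.eventually_all_finset]
    intro z hz
    have hc := continuous_predictor (φ := φ) z.1
    have hc : Continuous fun θ : ℝ => |z.2 - predictor φ ((1 - θ) • p + θ • p') z.1| := by
      fun_prop
    refine hc.continuousAt.eventually_lt continuousAt_const ?_
    simpa using hR z (Multiset.mem_toFinset.1 hz)
  exact this.mono fun θ h z hz => (h z (Multiset.mem_toFinset.2 hz)).le

/-- A short step from `p` towards any competitor keeps `R` inside the tube, where the two costs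
coincide; convexity turns this local comparison into a global one. The same step towards another
minimizer compares the offsets. -/
lemma IsSolution.of_add (hρ : 0 < ρ) (h : IsSolution φ ρ t (S + R) p)
    (hR : ∀ z ∈ R, |z.2 - predictor φ p z.1| < t) : IsSolution φ ρ t S p := by
  rw [isSolution_iff hρ] at h ⊢
  have h0 := cost_add_of_residual_le (ρ := ρ) (S := S) fun z hz => (hR z hz).le
  have key : ∀ p' : H × ℝ, ∃ θ : ℝ, 0 < θ ∧ θ ≤ 1 ∧
      cost φ ρ t (S + R) ((1 - θ) • p + θ • p') ≤
        (1 - θ) * cost φ ρ t (S + R) p + θ * cost φ ρ t S p' := by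
    intro p'
    have h1 : ∀ᶠ θ in 𝓝[>] (0 : ℝ), θ ∈ Set.Ioc (0 : ℝ) 1 := Ioc_mem_nhdsGT one_pos
    obtain ⟨θ, hθ, hθ0, hθ1⟩ :=
      (((eventually_residual_combo_le hR p').filter_mono nhdsWithin_le_nhds).and h1).exists
    refine ⟨θ, hθ0, hθ1, ?_⟩
    rw [cost_add_of_residual_le hθ, h0]
    refine (cost_combo_le hρ (by linarith) hθ0.le (by ring)).trans (sub_le_self _ ?_)
    exact mul_nonneg (mul_nonneg (by linarith) hθ0.le) (sq_nonneg _)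
  have hmin : ∀ p', cost φ ρ t S p ≤ cost φ ρ t S p' := by
    intro p'
    obtain ⟨θ, hθ0, hθ1, hθ⟩ := key p'
    have := (h.1 _).trans hθ
    rw [h0] at this
    exact le_of_mul_le_mul_left (by linarith) hθ0
  refine ⟨hmin, fun p' hp' => ?_⟩
  obtain ⟨θ, hθ0, hθ1, hθ⟩ := key p'
  have h2 := h.2 _ fun p'' => (hθ.trans (by
    have := hp' p
    nlinarith : _ ≤ cost φ ρ t (S + R) p)).trans (h.1 p'')
  have h3 : |((1 - θ) • p + θ • p').2| ≤ (1 - θ) * |p.2| + θ * |p'.2| := by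
    simp only [Prod.snd_add, Prod.smul_snd, smul_eq_mul]
    refine (abs_add_le _ _).trans_eq ?_
    rw [abs_mul, abs_mul, abs_of_nonneg hθ0.le, abs_of_nonneg (sub_nonneg.2 hθ1)]
  exact le_of_mul_le_mul_left (by linarith) hθ0

/-- Bounded sets of `H` need not be compact, so strong convexity is used to make the weights of a
minimizing sequence Cauchy. The loss of a single example bounds the offsets, hence the separate case
of the empty sample. -/
lemma exists_isMin_cost [CompleteSpace H] (hρ : 0 < ρ) :
    ∃ p : H × ℝ, ∀ p', cost φ ρ t S p ≤ cost φ ρ t S p' := by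
  rcases S.empty_or_exists_mem with rfl | ⟨z₀, hz₀⟩
  · exact ⟨0, fun p' => by simp [cost]⟩
  set v := ⨅ p : H × ℝ, cost φ ρ t S p
  have hbdd : BddBelow (Set.range (cost φ ρ t S)) :=
    ⟨0, Set.forall_mem_range.2 fun _ => cost_nonneg hρ⟩
  have hv : ∀ p, v ≤ cost φ ρ t S p := ciInf_le hbdd
  have hex : ∀ n : ℕ, ∃ p : H × ℝ, cost φ ρ t S p < v + 1 / ((n : ℝ) + 1) := fun n =>
    exists_lt_of_ciInf_lt (lt_add_of_pos_right _ Nat.one_div_pos_of_nat)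
  choose p hp using hex
  have hlim : Tendsto (fun n => cost φ ρ t S (p n)) atTop (𝓝 v) := by
    refine tendsto_of_tendsto_of_tendsto_of_le_of_le tendsto_const_nhds
      (g := fun _ => v) (h := fun n : ℕ => v + 1 / ((n : ℝ) + 1)) ?_ (fun n => hv _)
      fun n => (hp n).le
    simpa using tendsto_one_div_add_atTop_nhds_zero_nat.const_add v
  have hcauchy : CauchySeq fun n => (p n).1 := by
    refine cauchySeq_of_le_tendsto_0 (fun n : ℕ => √(4 * (1 / ((n : ℝ) + 1)))) ?_ ?_
    · intro n m k hn hm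
      rw [dist_eq_norm]
      refine Real.le_sqrt_of_sq_le ?_
      have h1 := cost_combo_le (φ := φ) (t := t) (S := S) (p := p n) (p' := p m) hρ
        (a := 1 / 2) (b := 1 / 2) (by norm_num) (by norm_num) (by norm_num)
      have h2 := hv ((1 / 2 : ℝ) • p n + (1 / 2 : ℝ) • p m)
      have h3 : 1 / ((n : ℝ) + 1) ≤ 1 / ((k : ℝ) + 1) := Nat.one_div_le_one_div hn
      have h4 : 1 / ((m : ℝ) + 1) ≤ 1 / ((k : ℝ) + 1) := Nat.one_div_le_one_div hm
      linarith [hp n, hp m]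
    · have := (tendsto_one_div_add_atTop_nhds_zero_nat (𝕜 := ℝ)).const_mul 4
      rw [mul_zero] at this
      have h := (Real.continuous_sqrt.tendsto 0).comp this
      rwa [Real.sqrt_zero] at h
  obtain ⟨w, hw⟩ := cauchySeq_tendsto_of_complete hcauchy
  have hb : Bornology.IsBounded (Set.range fun n => (p n).2) := by
    obtain ⟨C, hC⟩ := (isBounded_iff_forall_norm_le.1 (Metric.isBounded_range_of_tendsto _ hw))
    rw [isBounded_iff_forall_norm_le]
    refine ⟨|z₀.2| + C * ‖φ z₀.1‖ + t + (v + 1) / ρ, Set.forall_mem_range.2 fun n => ?_⟩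
    have h1 : loss φ t (p n) z₀ ≤ (S.map (loss φ t (p n))).sum :=
      Multiset.single_le_sum (fun x hx => by
        obtain ⟨z, -, rfl⟩ := Multiset.mem_map.1 hx
        exact loss_nonneg z) _ (Multiset.mem_map_of_mem _ hz₀)
    have h2 : ρ * (S.map (loss φ t (p n))).sum ≤ v + 1 := by
      have h3 : 1 / ((n : ℝ) + 1) ≤ 1 := by
        simpa using Nat.one_div_le_one_div (α := ℝ) (Nat.zero_le n)
      have h4 : ρ * (S.map (loss φ t (p n))).sum ≤ cost φ ρ t S (p n) :=
        le_add_of_nonneg_left (sq_nonneg _)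
      linarith [hp n]
    have h3 : loss φ t (p n) z₀ ≤ (v + 1) / ρ := by
      rw [le_div_iff₀ hρ]
      nlinarith
    have h4 : |z₀.2 - predictor φ (p n) z₀.1| - t ≤ loss φ t (p n) z₀ := le_max_right _ _
    have h5 : |inner ℝ (p n).1 (φ z₀.1)| ≤ C * ‖φ z₀.1‖ :=
      (abs_real_inner_le_norm _ _).trans
        (mul_le_mul_of_nonneg_right (hC _ ⟨n, rfl⟩) (norm_nonneg _))
    rw [Real.norm_eq_abs]
    have h6 : (p n).2 = z₀.2 - inner ℝ (p n).1 (φ z₀.1) - (z₀.2 - predictor φ (p n) z₀.1) := by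
      simp only [predictor]
      ring
    rw [h6]
    have h7 := abs_sub (z₀.2 - inner ℝ (p n).1 (φ z₀.1)) (z₀.2 - predictor φ (p n) z₀.1)
    have h8 := abs_sub z₀.2 (inner ℝ (p n).1 (φ z₀.1))
    linarith
  obtain ⟨b, -, ψ, hψ, hbψ⟩ := tendsto_subseq_of_bounded hb fun n => Set.mem_range_self n
  refine ⟨(w, b), fun p' => ?_⟩
  have h1 : Tendsto (fun n => cost φ ρ t S (p (ψ n))) atTop (𝓝 (cost φ ρ t S (w, b))) :=
    (continuous_cost.tendsto (w, b)).comp ((hw.comp hψ.tendsto_atTop).prodMk_nhds hbψ)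
  rw [tendsto_nhds_unique h1 (hlim.comp hψ.tendsto_atTop)]
  exact hv p'

lemma exists_isSolution [CompleteSpace H] (hρ : 0 < ρ) (S : Multiset (X × ℝ)) :
    ∃ p, IsSolution φ ρ t S p := by
  obtain ⟨p, hp⟩ := exists_isMin_cost (φ := φ) (t := t) (S := S) hρ
  -- All minimizers share the weight `p.1`, so the tie-break asks for the point nearest to `0` in a
  -- closed set of reals.
  have hclosed : IsClosed {b : ℝ | cost φ ρ t S (p.1, b) ≤ cost φ ρ t S p} :=
    isClosed_le (continuous_cost.comp (by fun_prop)) continuous_const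
  obtain ⟨b, hb, hbd⟩ := hclosed.exists_infDist_eq_dist ⟨p.2, le_refl (cost φ ρ t S p)⟩ 0
  refine ⟨(p.1, b), (isSolution_iff hρ).2 ⟨fun p' => le_trans hb (hp p'), fun p' hp' => ?_⟩⟩
  have h1 : p'.1 = p.1 := by
    have := norm_sub_sq_le_of_isMin (p' := p') hρ hp
    rw [le_antisymm (hp' p) (hp p'), sub_self, mul_zero] at this
    exact sub_eq_zero.1 (norm_eq_zero.1 (pow_eq_zero_iff two_ne_zero |>.1
      (le_antisymm this (sq_nonneg _))))
  have h2 : p'.2 ∈ {b : ℝ | cost φ ρ t S (p.1, b) ≤ cost φ ρ t S p} := by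
    rw [Set.mem_ofPred_eq, ← h1]
    exact hp' p
  have := Metric.infDist_le_dist_of_mem (x := 0) h2
  rw [hbd] at this
  simpa [dist_eq_norm] using this

lemma isSolution_solution [CompleteSpace H] (hρ : 0 < ρ) (S : Multiset (X × ℝ)) :
    IsSolution φ ρ t S (solution φ ρ t S) :=
  Classical.epsilon_spec (exists_isSolution hρ S)

lemma IsSolution.solution_eq (hρ : 0 < ρ) (h : IsSolution φ ρ t S p) :
    solution φ ρ t S = p :=
  (Classical.epsilon_spec (p := IsSolution φ ρ t S) ⟨p, h⟩ : IsSolution φ ρ t S _).unique hρ h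

lemma solution_add [CompleteSpace H] (hρ : 0 < ρ)
    (hR : ∀ z ∈ R, |z.2 - algorithm φ ρ t S z.1| ≤ t) :
    solution φ ρ t (S + R) = solution φ ρ t S :=
  ((isSolution_solution hρ S).add hρ hR).solution_eq hρ

lemma solution_of_add [CompleteSpace H] (hρ : 0 < ρ)
    (hR : ∀ z ∈ R, |z.2 - algorithm φ ρ t (S + R) z.1| < t) :
    solution φ ρ t S = solution φ ρ t (S + R) :=
  ((isSolution_solution hρ (S + R)).of_add hρ hR).solution_eq hρ

/-- Nearly optimal parameters for the training cost with a vanishing quadratic penalty on the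
offset converge to the solution. -/
lemma tendsto_of_nearly_optimal (hρ : 0 < ρ) (h : IsSolution φ ρ t S p) {q : ℕ → H × ℝ} {ε : ℕ → ℝ}
    (hε0 : ∀ n, 0 < ε n) (hε : Tendsto ε atTop (𝓝 0))
    (hq : ∀ n, cost φ ρ t S (q n) + ε n * (q n).2 ^ 2 ≤
      cost φ ρ t S p + ε n * p.2 ^ 2 + ε n ^ 2) : Tendsto q atTop (𝓝 p) := by
  have hs := h
  rw [isSolution_iff hρ] at h
  -- The tolerance is `ε n ^ 2` so that the error still vanishes after division by the penalty
  -- weight `ε n`.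
  have hb : ∀ n, (q n).2 ^ 2 ≤ p.2 ^ 2 + ε n := fun n =>
    le_of_mul_le_mul_left (by linarith [hq n, h.1 (q n)]) (hε0 n)
  have hc : Tendsto (fun n => cost φ ρ t S (q n)) atTop (𝓝 (cost φ ρ t S p)) := by
    refine tendsto_of_tendsto_of_tendsto_of_le_of_le tendsto_const_nhds
      (g := fun _ => cost φ ρ t S p)
      (h := fun n : ℕ => cost φ ρ t S p + ε n * p.2 ^ 2 + ε n ^ 2) ?_ (fun n => h.1 _)
      fun n => ?_
    · simpa using (((hε.mul_const (p.2 ^ 2)).const_add (cost φ ρ t S p)).add (hε.pow 2))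
    · have := mul_nonneg (hε0 n).le (sq_nonneg (q n).2)
      dsimp only
      linarith [hq n]
  have hw : Tendsto (fun n => (q n).1) atTop (𝓝 p.1) := by
    rw [tendsto_iff_norm_sub_tendsto_zero]
    have h1 : Tendsto (fun n => √(2 * (cost φ ρ t S (q n) - cost φ ρ t S p))) atTop (𝓝 0) := by
      have := (hc.sub_const (cost φ ρ t S p)).const_mul 2
      rw [sub_self, mul_zero] at this
      have h' := (Real.continuous_sqrt.tendsto 0).comp this
      rwa [Real.sqrt_zero] at h'
    exact squeeze_zero (fun _ => norm_nonneg _)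
      (fun n => Real.le_sqrt_of_sq_le (norm_sub_sq_le_of_isMin hρ h.1)) h1
  refine hw.prodMk_nhds (tendsto_of_subseq_tendsto fun ns hns => ?_)
  obtain ⟨C, hC⟩ := isBounded_iff_forall_norm_le.1 (Metric.isBounded_range_of_tendsto _ hε)
  have hbd : Bornology.IsBounded (Set.range fun n => (q (ns n)).2) := by
    rw [isBounded_iff_forall_norm_le]
    refine ⟨√(p.2 ^ 2 + C), Set.forall_mem_range.2 fun n => ?_⟩
    refine Real.le_sqrt_of_sq_le ?_
    have h1 := hC _ ⟨ns n, rfl⟩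
    rw [Real.norm_eq_abs] at h1 ⊢
    rw [sq_abs]
    linarith [hb (ns n), le_abs_self (ε (ns n))]
  obtain ⟨b, -, ψ, hψ, hbψ⟩ := tendsto_subseq_of_bounded hbd fun n => Set.mem_range_self n
  refine ⟨ψ, ?_⟩
  have hsub : Tendsto (fun n => ns (ψ n)) atTop atTop := hns.comp hψ.tendsto_atTop
  have h1 : Tendsto (fun n => cost φ ρ t S (q (ns (ψ n)))) atTop (𝓝 (cost φ ρ t S (p.1, b))) :=
    (continuous_cost.tendsto (p.1, b)).comp ((hw.comp hsub).prodMk_nhds hbψ)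
  have h2 : cost φ ρ t S (p.1, b) = cost φ ρ t S p := tendsto_nhds_unique h1 (hc.comp hsub)
  have h3 : b ^ 2 ≤ p.2 ^ 2 :=
    le_of_tendsto_of_tendsto (hbψ.pow 2) (b := atTop)
      (by simpa using (hε.comp hsub).const_add (p.2 ^ 2))
      (Eventually.of_forall fun n => hb (ns (ψ n)))
  have h4 : IsSolution φ ρ t S (p.1, b) := by
    refine (isSolution_iff hρ).2 ⟨fun p' => h2.le.trans (h.1 p'), fun p' hp' => ?_⟩
    exact (sq_le_sq.1 h3).trans (h.2 p' hp')
  rw [hs.unique hρ h4]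
  exact hbψ

end Deterministic

/-! ### The active set and the size of the compression. -/

section Selection

variable {X H : Type*} [NormedAddCommGroup H] [InnerProductSpace ℝ H]
  {ι κ : Type*} [Fintype ι] [Fintype κ]

/-- The multiset of the examples of a finite family. -/
def sample (z : ι → X × ℝ) : Multiset (X × ℝ) := Finset.univ.val.map z

lemma mem_sample {z : ι → X × ℝ} {a : X × ℝ} : a ∈ sample z ↔ ∃ i, z i = a := by
  simp [sample]

lemma sample_comp_equiv (e : ι ≃ κ) (z : κ → X × ℝ) : sample (fun i => z (e i)) = sample z := by
  unfold sample
  rw [← Finset.map_univ_equiv e, Finset.map_val, Multiset.map_map]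
  rfl

lemma sample_eq_add (p : ι → Prop) [DecidablePred p] [Fintype {i // p i}] [Fintype {i // ¬ p i}]
    (z : ι → X × ℝ) :
    sample z = sample (fun i : {i // p i} => z i) + sample (fun i : {i // ¬ p i} => z i) := by
  have h1 := Finset.univ_val_map_subtype_restrict z p
  have h2 := Finset.univ_val_map_subtype_restrict z fun i => ¬ p i
  change sample (fun i : {i // p i} => z i) = _ at h1
  change sample (fun i : {i // ¬ p i} => z i) = _ at h2
  rw [h1, h2, ← Multiset.map_add, Finset.filter_val, Finset.filter_val, Multiset.filter_add_not]
  rfl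

open Classical in
/-- The indices of the examples whose residual is at least `t`. -/
noncomputable def active (φ : X → H) (ρ t : ℝ) (z : ι → X × ℝ) : Finset ι :=
  {i | t ≤ |(z i).2 - algorithm φ ρ t (sample z) (z i).1|}

variable {φ : X → H} {ρ t : ℝ}

lemma mem_active {z : ι → X × ℝ} {i : ι} :
    i ∈ active φ ρ t z ↔ t ≤ |(z i).2 - algorithm φ ρ t (sample z) (z i).1| := by
  simp [active]

lemma solution_eq_of_active_eq [CompleteSpace H] [DecidableEq ι] (hρ : 0 < ρ) {z : ι → X × ℝ} {K : Finset ι}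
    (h : active φ ρ t z = K) :
    solution φ ρ t (sample z) = solution φ ρ t (sample fun i : {i // i ∈ K} => z i) := by
  have hs := sample_eq_add (· ∈ K) z
  have := solution_of_add (φ := φ) (t := t) (S := sample fun i : {i // i ∈ K} => z i)
    (R := sample fun i : {i // i ∉ K} => z i) hρ fun a ha => by
      obtain ⟨i, rfl⟩ := mem_sample.1 ha
      have hi : (i : ι) ∉ active φ ρ t z := by
        rw [h]
        exact i.2
      rw [mem_active, not_le, hs] at hi
      exact hi
  rw [this, ← hs]

/-- A set `K` of indices is the active one iff all the examples in `K` are active when the training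
is on `K` only, and the other examples are well inside the tube of the resulting predictor. -/
lemma active_eq_iff [CompleteSpace H] [DecidableEq ι] (hρ : 0 < ρ) (z : ι → X × ℝ) (K : Finset ι) :
    active φ ρ t z = K ↔
      active φ ρ t (fun i : {i // i ∈ K} => z i) = Finset.univ ∧
        ∀ i : {i // i ∉ K},
          |(z i).2 - algorithm φ ρ t (sample fun i : {i // i ∈ K} => z i) (z i).1| < t := by
  constructor
  · intro h
    have hs := solution_eq_of_active_eq hρ h
    refine ⟨Finset.eq_univ_of_forall fun i => ?_, fun i => ?_⟩
    · have hi : (i : ι) ∈ active φ ρ t z := by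
        rw [h]
        exact i.2
      rw [mem_active, algorithm, hs] at hi
      exact mem_active.2 hi
    · have hi : (i : ι) ∉ active φ ρ t z := by
        rw [h]
        exact i.2
      rw [mem_active, algorithm, hs, not_le] at hi
      exact hi
  · rintro ⟨h1, h2⟩
    have hs : solution φ ρ t (sample z) =
        solution φ ρ t (sample fun i : {i // i ∈ K} => z i) := by
      rw [sample_eq_add (· ∈ K) z]
      refine solution_add hρ fun a ha => ?_
      obtain ⟨i, rfl⟩ := mem_sample.1 ha
      exact (h2 i).le
    ext i
    rw [mem_active, algorithm, hs]
    constructor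
    · intro hi
      by_contra hK
      exact (h2 ⟨i, hK⟩).not_ge hi
    · intro hi
      have : (⟨i, hi⟩ : {i // i ∈ K}) ∈ active φ ρ t (fun i : {i // i ∈ K} => z i) := by
        rw [h1]
        exact Finset.mem_univ _
      rw [mem_active] at this
      exact this

open Classical in
/-- The examples with residual exactly `t`. -/
noncomputable def boundary (φ : X → H) (ρ t : ℝ) (S : Multiset (X × ℝ)) : Multiset (X × ℝ) :=
  S.filter fun z => |z.2 - algorithm φ ρ t S z.1| = t

open Classical in
lemma violated_add_boundary (S : Multiset (X × ℝ)) :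
    violated φ ρ t S + boundary φ ρ t S =
      S.filter fun z => t ≤ |z.2 - algorithm φ ρ t S z.1| := by
  rw [violated, boundary, Multiset.filter_add_filter,
    Multiset.filter_eq_nil (p := fun z => _ ∧ _) |>.2, add_zero]
  · refine Multiset.filter_congr fun z _ => ?_
    rw [le_iff_lt_or_eq, eq_comm (a := t)]
  · rintro z - ⟨h1, h2⟩
    exact h1.ne' h2

lemma isCandidate_boundary [CompleteSpace H] (hρ : 0 < ρ) (S : Multiset (X × ℝ)) :
    IsCandidate φ ρ t S (boundary φ ρ t S) := by
  classical
  refine ⟨Multiset.filter_le _ _, fun z hz => (Multiset.mem_filter.1 hz).2, ?_⟩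
  have h : violated φ ρ t S + boundary φ ρ t S +
      S.filter (fun z => ¬ t ≤ |z.2 - algorithm φ ρ t S z.1|) = S := by
    rw [violated_add_boundary, Multiset.filter_add_not]
  have := solution_of_add (φ := φ) (t := t) (S := violated φ ρ t S + boundary φ ρ t S)
    (R := S.filter (fun z => ¬ t ≤ |z.2 - algorithm φ ρ t S z.1|)) hρ fun z hz => by
      rw [h]
      exact not_le.1 (Multiset.mem_filter.1 hz).2
  rwa [h] at this

/-- `S` has finitely many sub-multisets, so both minima in the selection rule are attained and the
`Classical.epsilon` choice is genuine. -/
lemma isCandidate_support [CompleteSpace H] [LinearOrder X] (hρ : 0 < ρ) (S : Multiset (X × ℝ)) :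
    IsCandidate φ ρ t S (support φ ρ t S) := by
  classical
  have hfin : {T | IsCandidate φ ρ t S T}.Finite :=
    S.powerset.finite_toSet.subset fun T hT => Multiset.mem_powerset.2 hT.1
  obtain ⟨T₁, hT₁, hmin⟩ :=
    Set.exists_min_image _ Multiset.card hfin ⟨_, isCandidate_boundary hρ S⟩
  have hfin' : {T | IsSmallestCandidate φ ρ t S T}.Finite := hfin.subset fun T hT => hT.1
  obtain ⟨T₂, hT₂, hmin'⟩ := Set.exists_min_image _ tieKey hfin' ⟨T₁, hT₁, hmin⟩
  exact (Classical.epsilon_spec (p := IsSelected φ ρ t S) ⟨T₂, hT₂, hmin'⟩).1.1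

/-- If no example lies on the boundary of the tube trained on the other examples, then all the
boundary examples are needed. -/
lemma IsCandidate.eq_boundary [CompleteSpace H] (hρ : 0 < ρ) {S T : Multiset (X × ℝ)} (hT : IsCandidate φ ρ t S T)
    (h : ∀ a S', S = a ::ₘ S' → |a.2 - algorithm φ ρ t S' a.1| ≠ t) :
    T = boundary φ ρ t S := by
  classical
  obtain ⟨hTS, hTt, hsol⟩ := hT
  have hTB : T ≤ boundary φ ρ t S := Multiset.le_filter.2 ⟨hTS, hTt⟩
  by_contra hne
  obtain ⟨a, ha⟩ := Multiset.lt_iff_cons_le.1 (lt_of_le_of_ne hTB hne)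
  obtain ⟨B', hB'⟩ := Multiset.le_iff_exists_add.1 ha
  have haB : a ∈ boundary φ ρ t S := Multiset.mem_of_le ha (Multiset.mem_cons_self _ _)
  -- A boundary example `a` left out by `T` can be removed from `S`: what remains contains `S₊ + T`
  -- and otherwise only residuals at most `t`, so the solution is unchanged. Then `a` lies on the
  -- boundary of the tube trained without it.
  have hS : S = a ::ₘ (violated φ ρ t S + T +
      (B' + S.filter (fun z => ¬ t ≤ |z.2 - algorithm φ ρ t S z.1|))) := by
    conv_lhs => rw [← Multiset.filter_add_not
      (p := fun z => t ≤ |z.2 - algorithm φ ρ t S z.1|) S, ← violated_add_boundary, hB']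
    rw [← Multiset.singleton_add, ← Multiset.singleton_add]
    abel
  refine h a _ hS ?_
  rw [algorithm, solution_add hρ, hsol]
  · exact (Multiset.mem_filter.1 haB).2
  · intro z hz
    rw [algorithm, hsol]
    rcases Multiset.mem_add.1 hz with hz | hz
    · have : z ∈ boundary φ ρ t S := hB' ▸ Multiset.mem_add.2 (Or.inr hz)
      exact (Multiset.mem_filter.1 this).2.le
    · exact (not_le.1 (Multiset.mem_filter.1 hz).2).le

lemma card_compression_eq [CompleteSpace H] [LinearOrder X] [DecidableEq ι] (hρ : 0 < ρ) (z : ι → X × ℝ)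
    (h : ∀ j, |(z j).2 -
      algorithm φ ρ t (sample fun i : {i // i ≠ j} => z i) (z j).1| ≠ t) :
    (compression φ ρ t (sample z)).card = (active φ ρ t z).card := by
  classical
  rw [compression, (isCandidate_support hρ _).eq_boundary hρ, violated_add_boundary]
  · rw [sample, Multiset.filter_map, Multiset.card_map, active, Finset.card_def,
      Finset.filter_val]
    rfl
  · intro a S' hS
    obtain ⟨j, rfl⟩ := mem_sample.1 (hS ▸ Multiset.mem_cons_self a S' : a ∈ sample z)
    have h1 : sample (fun i : {i // ¬ i ≠ j} => z i) = {z j} := by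
      have : Unique {i // ¬ i ≠ j} := ⟨⟨⟨j, by simp⟩⟩, fun i => Subtype.ext (not_not.1 i.2)⟩
      rw [sample, Finset.univ_unique]
      simp only [Finset.singleton_val, Multiset.map_singleton]
      rw [not_not.1 (default : {i // ¬ i ≠ j}).2]
    rw [sample_eq_add (· ≠ j) z, h1, add_comm, Multiset.singleton_add,
      Multiset.cons_inj_right] at hS
    rw [← hS]
    exact h j

end Selection

/-! ### Measurability of the trained predictor. -/

section Measurability

open Filter Topology

variable {X H : Type*} [NormedAddCommGroup H] [InnerProductSpace ℝ H]
  {ι : Type*} [Fintype ι] {φ : X → H} {ρ t : ℝ}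

/-- Parameters whose weight vector is a combination of the features of the examples. -/
noncomputable def spanParam (φ : X → H) (z : ι → X × ℝ) (c : (ι → ℝ) × ℝ) : H × ℝ :=
  (∑ i, c.1 i • φ (z i).1, c.2)

/-- The training cost, with a quadratic penalty on the offset, in terms of coefficients. -/
noncomputable def spanCost (φ : X → H) (ρ t ε : ℝ) (z : ι → X × ℝ) (c : (ι → ℝ) × ℝ) : ℝ :=
  cost φ ρ t (sample z) (spanParam φ z c) + ε * c.2 ^ 2

lemma cost_sample (z : ι → X × ℝ) (p : H × ℝ) :
    cost φ ρ t (sample z) p = ‖p.1‖ ^ 2 + ρ * ∑ i, loss φ t p (z i) := by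
  rw [cost, sample, Multiset.map_map]
  rfl

lemma continuous_spanCost (ε : ℝ) (z : ι → X × ℝ) : Continuous (spanCost φ ρ t ε z) := by
  refine (continuous_cost.comp ?_).add (by fun_prop)
  unfold spanParam
  fun_prop

lemma spanCost_nonneg (hρ : 0 < ρ) {ε : ℝ} (hε : 0 < ε) (z : ι → X × ℝ) (c : (ι → ℝ) × ℝ) :
    0 ≤ spanCost φ ρ t ε z c :=
  add_nonneg (cost_nonneg hρ) (mul_nonneg hε.le (sq_nonneg _))

/-- The solution is a combination of the features of the examples. -/
lemma IsSolution.exists_spanParam (hρ : 0 < ρ) {z : ι → X × ℝ} {p : H × ℝ}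
    (h : IsSolution φ ρ t (sample z) p) : ∃ c, p = spanParam φ z c := by
  have hm := ((isSolution_iff hρ).1 h).1
  -- Projecting the weight onto `V` preserves all predictions on the sample and strictly lowers the
  -- norm unless the weight is already in `V`.
  set V := Submodule.span ℝ (Set.range fun i => φ (z i).1)
  have : FiniteDimensional ℝ V := FiniteDimensional.span_of_finite ℝ (Set.finite_range _)
  set w : H := V.starProjection p.1
  have hw : w ∈ V := V.starProjection_apply_mem p.1
  have horth : p.1 - w ∈ Vᗮ := V.sub_starProjection_mem_orthogonal p.1
  have hinner : ∀ i, inner ℝ w (φ (z i).1) = inner ℝ p.1 (φ (z i).1) := by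
    intro i
    have := Submodule.inner_left_of_mem_orthogonal
      (Submodule.subset_span (Set.mem_range_self i) : φ (z i).1 ∈ V) horth
    rw [inner_sub_left] at this
    linarith
  have hcost := hm (w, p.2)
  have hloss : ∀ i, loss φ t (w, p.2) (z i) = loss φ t p (z i) := fun i => by
    simp only [loss, predictor, hinner]
  simp only [cost_sample, hloss] at hcost
  have hpw : p.1 = w := by
    have h1 : ‖p.1‖ ^ 2 = ‖p.1 - w‖ ^ 2 + ‖w‖ ^ 2 := by
      have h2 := Submodule.inner_left_of_mem_orthogonal hw horth
      have h3 := norm_add_sq_real (p.1 - w) w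
      rw [sub_add_cancel, h2] at h3
      linarith
    have h4 : ‖p.1 - w‖ ^ 2 ≤ 0 := by linarith
    exact sub_eq_zero.1 (norm_eq_zero.1 (pow_eq_zero_iff two_ne_zero |>.1
      (le_antisymm h4 (sq_nonneg _))))
  obtain ⟨c, hc⟩ := (Submodule.mem_span_range_iff_exists_fun ℝ).1 hw
  exact ⟨(c, p.2), Prod.ext (hpw.trans hc.symm) rfl⟩

lemma predictor_spanParam (z : ι → X × ℝ) (c : (ι → ℝ) × ℝ) (x : X) :
    predictor φ (spanParam φ z c) x = ∑ i, c.1 i * inner ℝ (φ (z i).1) (φ x) + c.2 := by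
  simp only [predictor, spanParam, sum_inner, real_inner_smul_left]

variable [MeasurableSpace X]

lemma measurable_inner_comp {α : Type*} [MeasurableSpace α]
    (hφ : Measurable fun q : X × X => inner ℝ (φ q.1) (φ q.2)) {f g : α → X} (hf : Measurable f)
    (hg : Measurable g) : Measurable fun a => inner ℝ (φ (f a)) (φ (g a)) :=
  hφ.comp (hf.prodMk hg)

lemma measurable_predictor_spanParam {α : Type*} [MeasurableSpace α]
    (hφ : Measurable fun q : X × X => inner ℝ (φ q.1) (φ q.2)) {f : α → ι → X × ℝ} {g : α → X}
    (hf : Measurable f) (hg : Measurable g) (c : (ι → ℝ) × ℝ) :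
    Measurable fun a => predictor φ (spanParam φ (f a) c) (g a) := by
  simp only [predictor_spanParam]
  refine (Finset.measurable_sum _ fun i _ => Measurable.const_mul ?_ _).add_const _
  exact measurable_inner_comp hφ (measurable_pi_iff.1 hf i).fst hg

lemma measurable_spanCost (hφ : Measurable fun q : X × X => inner ℝ (φ q.1) (φ q.2)) (ε : ℝ)
    (c : (ι → ℝ) × ℝ) : Measurable fun z : ι → X × ℝ => spanCost φ ρ t ε z c := by
  unfold spanCost
  simp only [cost_sample]
  refine Measurable.add_const (Measurable.add ?_ (Measurable.const_mul
    (Finset.measurable_sum _ fun i _ => ?_) _)) _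
  · have : ∀ z : ι → X × ℝ, ‖(spanParam φ z c).1‖ ^ 2 =
        ∑ i, c.1 i * ∑ j, c.1 j * inner ℝ (φ (z j).1) (φ (z i).1) := fun z => by
      rw [← real_inner_self_eq_norm_sq]
      simp only [spanParam, sum_inner, inner_sum, real_inner_smul_left, real_inner_smul_right]
      exact Finset.sum_congr rfl fun i _ => (Finset.mul_sum _ _ _).symm
    simp only [this]
    refine Finset.measurable_sum _ fun i _ => Measurable.const_mul
      (Finset.measurable_sum _ fun j _ => Measurable.const_mul ?_ _) _
    exact measurable_inner_comp hφ (by fun_prop) (by fun_prop)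
  · have := measurable_predictor_spanParam hφ (f := fun z : ι → X × ℝ => z)
      (g := fun z => (z i).1) (by fun_prop) (by fun_prop) c
    unfold loss
    refine measurable_const.max (Measurable.sub_const (Measurable.abs (Measurable.sub ?_ this)) _)
    fun_prop

/-- A measurable selection of nearly optimal coefficients from a dense sequence. -/
lemma exists_measurable_nearly_optimal (hρ : 0 < ρ)
    (hφ : Measurable fun q : X × X => inner ℝ (φ q.1) (φ q.2)) {d : ℕ → (ι → ℝ) × ℝ}
    (hd : DenseRange d) {ε : ℝ} (hε : 0 < ε) :
    ∃ k : (ι → X × ℝ) → ℕ, Measurable k ∧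
      ∀ z c, spanCost φ ρ t ε z (d (k z)) ≤ spanCost φ ρ t ε z c + ε ^ 2 := by
  classical
  let good : (ι → X × ℝ) → ℕ → Prop := fun z k =>
    ∀ l, spanCost φ ρ t ε z (d k) ≤ spanCost φ ρ t ε z (d l) + ε ^ 2
  have hgood : ∀ k, MeasurableSet {z | good z k} := fun k => by
    rw [Set.ofPred_forall]
    exact MeasurableSet.iInter fun l => measurableSet_le (measurable_spanCost hφ _ _)
      ((measurable_spanCost hφ _ _).add_const _)
  have hex : ∀ z, ∃ k, good z k := fun z => by
    have hbdd : BddBelow (Set.range fun k => spanCost φ ρ t ε z (d k)) :=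
      ⟨0, Set.forall_mem_range.2 fun k => spanCost_nonneg hρ hε _ _⟩
    obtain ⟨k, hk⟩ := exists_lt_of_ciInf_lt (lt_add_of_pos_right
      (⨅ k, spanCost φ ρ t ε z (d k)) (pow_pos hε 2))
    exact ⟨k, fun l => hk.le.trans (add_le_add_left (ciInf_le hbdd l) _)⟩
  refine ⟨fun z => Nat.find (hex z), measurable_find hex hgood, fun z c => ?_⟩
  exact hd.induction_on (p := fun c => spanCost φ ρ t ε z (d (Nat.find (hex z))) ≤
      spanCost φ ρ t ε z c + ε ^ 2) c
    (isClosed_le continuous_const ((continuous_spanCost _ _).add continuous_const))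
    (Nat.find_spec (hex z))

/-- The prediction is jointly measurable in the examples and the instance. -/
lemma measurable_algorithm [CompleteSpace H] (hρ : 0 < ρ)
    (hφ : Measurable fun q : X × X => inner ℝ (φ q.1) (φ q.2)) :
    Measurable fun q : (ι → X × ℝ) × X => algorithm φ ρ t (sample q.1) q.2 := by
  -- Since `H` carries no measurable structure, the selection is made among real coefficients,
  -- through kernel values only. The vanishing penalty on the offset reproduces the smallest-offset
  -- rule in the limit.
  obtain ⟨d, hd⟩ := TopologicalSpace.exists_dense_seq ((ι → ℝ) × ℝ)
  obtain ⟨ε, hε0, hε⟩ : ∃ ε : ℕ → ℝ, (∀ n, 0 < ε n) ∧ Tendsto ε atTop (𝓝 0) :=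
    ⟨fun n => 1 / ((n : ℝ) + 1), fun n => Nat.one_div_pos_of_nat,
      tendsto_one_div_add_atTop_nhds_zero_nat⟩
  choose k hk hmin using fun n =>
    exists_measurable_nearly_optimal (t := t) hρ hφ hd (hε0 n)
  have hmeas : ∀ n, Measurable fun q : (ι → X × ℝ) × X =>
      predictor φ (spanParam φ q.1 (d (k n q.1))) q.2 := fun n => by
    have h : Measurable fun q : ((ι → X × ℝ) × X) × ℕ =>
        predictor φ (spanParam φ q.1.1 (d q.2)) q.1.2 :=
      measurable_from_prod_countable_left fun l =>
        measurable_predictor_spanParam hφ measurable_fst measurable_snd (d l)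
    exact h.comp (measurable_id.prodMk ((hk n).comp measurable_fst))
  refine measurable_of_tendsto_metrizable hmeas (tendsto_pi_nhds.2 fun q => ?_)
  have hs := isSolution_solution (φ := φ) (t := t) hρ (sample q.1)
  obtain ⟨c, hc⟩ := hs.exists_spanParam hρ
  have hlim : Tendsto (fun n => spanParam φ q.1 (d (k n q.1))) atTop
      (𝓝 (solution φ ρ t (sample q.1))) := by
    refine tendsto_of_nearly_optimal hρ hs hε0 hε fun n => ?_
    rw [hc]
    exact hmin n q.1 c
  exact ((continuous_predictor q.2).tendsto _).comp hlim

end Measurability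

/-! ### The roots of `psiTilde`. -/

section Bounds

variable {N : ℕ} {δ : ℝ} {k : ℕ} {α : ℝ}

lemma continuousOn_psiTilde : ContinuousOn (psiTilde N δ k) (Set.Iio 1) := by
  unfold psiTilde
  refine ContinuousOn.add ?_ (by fun_prop)
  refine continuousOn_const.mul (continuousOn_finsetSum _ fun m _ => continuousOn_const.mul ?_)
  refine ContinuousOn.inv₀ (by fun_prop) fun x hx => ?_
  have : (0 : ℝ) < 1 - x := sub_pos.2 hx
  positivity

/-- Keeping only the term `m = N - 1` shows that `psiTilde` blows up as `α` tends to `1`. -/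
lemma exists_mul_inv_le_psiTilde (hδ : 0 < δ) (hk : k < N) :
    ∃ c : ℝ, 0 < c ∧ ∀ α < 1, c * (1 - α)⁻¹ ≤ psiTilde N δ k α := by
  have hN : (0 : ℝ) < N := by exact_mod_cast (Nat.zero_le k).trans_lt hk
  have h1 : (0 : ℝ) < (N - 1).choose k := by exact_mod_cast Nat.choose_pos (by omega)
  have h2 : (0 : ℝ) < N.choose k := by exact_mod_cast Nat.choose_pos hk.le
  refine ⟨δ / (2 * N) * (((N - 1).choose k : ℝ) / (N.choose k : ℝ)), by positivity,
    fun α hα => ?_⟩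
  have hα : 0 < 1 - α := sub_pos.2 hα
  have h3 : ((N - 1).choose k : ℝ) / (N.choose k : ℝ) * (1 - α)⁻¹ ≤
      ∑ m ∈ Finset.Ico k N, (m.choose k : ℝ) / (N.choose k : ℝ) * ((1 - α) ^ (N - m))⁻¹ := by
    have := Finset.single_le_sum
      (f := fun m => (m.choose k : ℝ) / (N.choose k : ℝ) * ((1 - α) ^ (N - m))⁻¹)
      (fun m _ => by positivity) (Finset.mem_Ico.2 (by omega : k ≤ N - 1 ∧ N - 1 < N))
    have h4 : N - (N - 1) = 1 := by omega
    simpa only [h4, pow_one] using this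
  unfold psiTilde
  rw [mul_assoc]
  exact (mul_le_mul_of_nonneg_left h3 (by positivity)).trans
    (le_add_of_nonneg_right (by positivity))

/-- The term `m = N + 1` alone forces blow-up as `α` tends to `-∞`. -/
lemma exists_mul_le_psiTilde (hδ : 0 < δ) (hN : 1 ≤ N) (hk : k ≤ N) :
    ∃ c : ℝ, 0 < c ∧ ∀ α < 1, c * (1 - α) ≤ psiTilde N δ k α := by
  have hN' : (0 : ℝ) < N := by exact_mod_cast hN
  have h1 : (0 : ℝ) < (N + 1).choose k := by exact_mod_cast Nat.choose_pos (by omega)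
  have h2 : (0 : ℝ) < N.choose k := by exact_mod_cast Nat.choose_pos hk
  refine ⟨δ / (6 * N) * (((N + 1).choose k : ℝ) / (N.choose k : ℝ)), by positivity,
    fun α hα => ?_⟩
  have hα : 0 < 1 - α := sub_pos.2 hα
  have h3 : ((N + 1).choose k : ℝ) / (N.choose k : ℝ) * (1 - α) ≤
      ∑ m ∈ Finset.Icc (N + 1) (4 * N),
        (m.choose k : ℝ) / (N.choose k : ℝ) * (1 - α) ^ (m - N) := by
    have := Finset.single_le_sum
      (f := fun m => (m.choose k : ℝ) / (N.choose k : ℝ) * (1 - α) ^ (m - N))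
      (fun m _ => by positivity)
      (Finset.mem_Icc.2 (by omega : N + 1 ≤ N + 1 ∧ N + 1 ≤ 4 * N))
    have h4 : N + 1 - N = 1 := by omega
    simpa only [h4, pow_one] using this
  unfold psiTilde
  rw [mul_assoc]
  exact (mul_le_mul_of_nonneg_left h3 (by positivity)).trans
    (le_add_of_nonneg_left (by positivity))

/-- A value below `1` here, with the blow-up at `1`, would produce a further root by the
intermediate value theorem. The number of roots is not needed. -/
lemma one_le_psiTilde_of_sSup_lt (hδ : 0 < δ) (hk : k < N) (hα : α < 1)
    (h : sSup (psiTildeRoots N δ k) < α) : 1 ≤ psiTilde N δ k α := by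
  by_contra! hlt
  obtain ⟨c, hc, hψ⟩ := exists_mul_inv_le_psiTilde hδ hk
  set β := max α (1 - c)
  have hβ : β < 1 := max_lt hα (by linarith)
  have hβ1 : 1 ≤ psiTilde N δ k β := by
    refine le_trans ?_ (hψ β hβ)
    rw [← div_eq_mul_inv, one_le_div (sub_pos.2 hβ)]
    linarith [le_max_right α (1 - c)]
  obtain ⟨γ, hγ, hγ1⟩ := intermediate_value_Icc (le_max_left α (1 - c))
    (continuousOn_psiTilde.mono fun x hx => lt_of_le_of_lt hx.2 hβ) ⟨hlt.le, hβ1⟩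
  have : γ ≤ sSup (psiTildeRoots N δ k) :=
    le_csSup ⟨1, fun x hx => hx.1.le⟩ ⟨lt_of_le_of_lt hγ.2 hβ, hγ1⟩
  linarith [hγ.1]

lemma one_le_psiTilde_of_lt_sInf (hδ : 0 < δ) (hN : 1 ≤ N) (hk : k ≤ N) (hα : α < 1)
    (h : α < sInf (psiTildeRoots N δ k)) : 1 ≤ psiTilde N δ k α := by
  by_contra! hlt
  obtain ⟨c, hc, hψ⟩ := exists_mul_le_psiTilde hδ hN hk
  set β := min α (1 - c⁻¹)
  have hβ : β < 1 := (min_le_left _ _).trans_lt hα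
  have hβ1 : 1 ≤ psiTilde N δ k β := by
    refine le_trans ?_ (hψ β hβ)
    have h1 : c⁻¹ ≤ 1 - β := by linarith [min_le_right α (1 - c⁻¹)]
    calc 1 = c * c⁻¹ := (mul_inv_cancel₀ hc.ne').symm
      _ ≤ c * (1 - β) := by gcongr
  obtain ⟨γ, hγ, hγ1⟩ := intermediate_value_Icc' (min_le_left α (1 - c⁻¹))
    (continuousOn_psiTilde.mono fun x hx => lt_of_le_of_lt hx.2 hα) ⟨hlt.le, hβ1⟩
  -- Without a lower bound on the roots, `sInf` would take its default value `0`.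
  have hbdd : BddBelow (psiTildeRoots N δ k) := by
    refine ⟨1 - c⁻¹, fun x hx => ?_⟩
    have h1 := hψ x hx.1
    rw [hx.2] at h1
    have : 1 - x ≤ c⁻¹ := by
      rw [← one_div, le_div_iff₀ hc]
      linarith
    linarith
  have : sInf (psiTildeRoots N δ k) ≤ γ := csInf_le hbdd ⟨lt_of_le_of_lt hγ.2 hα, hγ1⟩
  linarith [hγ.2]

lemma epsLower_le_one : epsLower N δ k ≤ 1 := by
  refine max_le zero_le_one ?_
  rcases (psiTildeRoots N δ k).eq_empty_or_nonempty with h | ⟨x, hx⟩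
  · rw [h, Real.sInf_empty]
    exact zero_le_one
  · by_cases hb : BddBelow (psiTildeRoots N δ k)
    · exact (csInf_le hb hx).trans hx.1.le
    · rw [Real.sInf_of_not_bddBelow hb]
      exact zero_le_one

/-- The dual feasible combination of powers of `1 - α` dominates the indicator of the complement of
`[epsLower, epsUpper]`, weighted by `(N choose k) (1 - α)^(N - k)`. -/
lemma choose_mul_pow_le (hδ : 0 < δ) (hN : 1 ≤ N) (hk : k ≤ N) (hα0 : 0 ≤ α) (hα1 : α ≤ 1)
    (h : ¬ (epsLower N δ k ≤ α ∧ α ≤ epsUpper N δ k)) :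
    (N.choose k : ℝ) * (1 - α) ^ (N - k) ≤
      ∑ m ∈ Finset.Ico k N, δ / (2 * N) * ((m.choose k : ℝ) * (1 - α) ^ (m - k)) +
      ∑ m ∈ Finset.Icc (N + 1) (4 * N), δ / (6 * N) * ((m.choose k : ℝ) * (1 - α) ^ (m - k)) := by
  have hq : 0 ≤ 1 - α := sub_nonneg.2 hα1
  rcases hα1.eq_or_lt with rfl | hα1
  -- At `α = 1` the function `psiTilde` is of no use. For `k = N` the interval contains `1`; for `k
  -- < N` the left side vanishes.
  · have hk' : k < N := by
      refine hk.lt_of_ne ?_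
      rintro rfl
      exact h ⟨epsLower_le_one, by simp [epsUpper]⟩
    have h0 : (1 - 1 : ℝ) ^ (N - k) = 0 := by
      rw [sub_self, zero_pow (by omega)]
    rw [h0, mul_zero]
    positivity
  have hψ : 1 ≤ psiTilde N δ k α := by
    rw [not_and_or, not_le, not_le] at h
    rcases h with h | h
    · rcases lt_max_iff.1 h with h | h
      · linarith
      · exact one_le_psiTilde_of_lt_sInf hδ hN hk hα1 h
    · unfold epsUpper at h
      split_ifs at h with hk'
      · exact one_le_psiTilde_of_sSup_lt hδ hk' hα1 h
      · linarith
  have hq : 0 < 1 - α := sub_pos.2 hα1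
  have hc : (0 : ℝ) < N.choose k := by exact_mod_cast Nat.choose_pos hk
  calc (N.choose k : ℝ) * (1 - α) ^ (N - k)
      ≤ (N.choose k : ℝ) * (1 - α) ^ (N - k) * psiTilde N δ k α :=
        le_mul_of_one_le_right (by positivity) hψ
    _ = _ := by
      rw [psiTilde, mul_add, ← mul_assoc, ← mul_assoc, Finset.mul_sum, Finset.mul_sum]
      congr 1
      · refine Finset.sum_congr rfl fun m hm => ?_
        obtain ⟨h1, h2⟩ := Finset.mem_Ico.1 hm
        have : N - k = (m - k) + (N - m) := by omega
        rw [this, pow_add]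
        field_simp
      · refine Finset.sum_congr rfl fun m hm => ?_
        obtain ⟨h1, h2⟩ := Finset.mem_Icc.1 hm
        have : m - k = (N - k) + (m - N) := by omega
        rw [this, pow_add]
        field_simp

end Bounds

/-! ### Weak duality for the moment problem. -/

section Duality

open ENNReal

/-- Weak duality: measures `ν k` on `[0, 1]` that satisfy the moment conditions for every sample
size give mass at most `δ` to the complements of the intervals `[epsLower, epsUpper]`. -/
lemma sum_lintegral_compl_le {N : ℕ} (hN : 1 ≤ N) {δ : ℝ} (hδ : 0 < δ) {ν : ℕ → Measure ℝ}
    (hν : ∀ k, ∀ᵐ s ∂ν k, s ∈ Set.Icc (0 : ℝ) 1)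
    (hmom : ∀ m, ∑ k ∈ Finset.range (m + 1),
      (m.choose k : ℝ≥0∞) * ∫⁻ s, ENNReal.ofReal (s ^ (m - k)) ∂ν k = 1) :
    ∑ k ∈ Finset.range (N + 1), (N.choose k : ℝ≥0∞) *
      ∫⁻ s, {s | epsLower N δ k ≤ 1 - s ∧ 1 - s ≤ epsUpper N δ k}ᶜ.indicator 1 s *
        ENNReal.ofReal (s ^ (N - k)) ∂ν k ≤ ENNReal.ofReal δ := by
  have hN' : (0 : ℝ) < N := by exact_mod_cast hN
  set M : ℕ → ℕ → ℝ≥0∞ := fun m k =>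
    (m.choose k : ℝ≥0∞) * ∫⁻ s, ENNReal.ofReal (s ^ (m - k)) ∂ν k with hM
  have hmeas : ∀ n : ℕ, Measurable fun s : ℝ => ENNReal.ofReal (s ^ n) := fun n => by fun_prop
  have hbound : ∀ k ∈ Finset.range (N + 1), (N.choose k : ℝ≥0∞) *
      ∫⁻ s, {s | epsLower N δ k ≤ 1 - s ∧ 1 - s ≤ epsUpper N δ k}ᶜ.indicator 1 s *
        ENNReal.ofReal (s ^ (N - k)) ∂ν k ≤
      ∑ m ∈ Finset.range N, ENNReal.ofReal (δ / (2 * N)) * M m k +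
        ∑ m ∈ Finset.Icc (N + 1) (4 * N), ENNReal.ofReal (δ / (6 * N)) * M m k := by
    intro k hk
    have hk : k ≤ N := Nat.lt_succ_iff.1 (Finset.mem_range.1 hk)
    have hint : ∀ (c : ℝ≥0∞) (A : Finset ℕ), ∑ m ∈ A, c * M m k =
        ∫⁻ s, ∑ m ∈ A, c * ((m.choose k : ℝ≥0∞) * ENNReal.ofReal (s ^ (m - k))) ∂ν k := by
      intro c A
      rw [lintegral_finsetSum _ fun m _ => ((hmeas _).const_mul _).const_mul _]
      refine Finset.sum_congr rfl fun m _ => ?_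
      rw [lintegral_const_mul _ ((hmeas _).const_mul _), lintegral_const_mul _ (hmeas _)]
    rw [hint, hint, ← lintegral_const_mul' _ _ (ENNReal.natCast_ne_top _),
      ← lintegral_add_left (Finset.measurable_sum _ fun m _ =>
        ((hmeas _).const_mul _).const_mul _)]
    refine lintegral_mono_ae ((hν k).mono fun s hs => ?_)
    by_cases hbad : s ∈ {s | epsLower N δ k ≤ 1 - s ∧ 1 - s ≤ epsUpper N δ k}ᶜ
    · have hreal := choose_mul_pow_le hδ hN hk (sub_nonneg.2 hs.2) (sub_le_self 1 hs.1) hbad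
      rw [_root_.sub_sub_cancel] at hreal
      have hs0 : 0 ≤ s := hs.1
      have hcast : ∀ (c : ℝ) (A : Finset ℕ), 0 ≤ c →
          ENNReal.ofReal (∑ m ∈ A, c * ((m.choose k : ℝ) * s ^ (m - k))) =
          ∑ m ∈ A, ENNReal.ofReal c * ((m.choose k : ℝ≥0∞) * ENNReal.ofReal (s ^ (m - k))) := by
        intro c A hc
        rw [ENNReal.ofReal_sum_of_nonneg fun m _ => by positivity]
        refine Finset.sum_congr rfl fun m _ => ?_
        rw [ENNReal.ofReal_mul hc, ENNReal.ofReal_mul (Nat.cast_nonneg _), ENNReal.ofReal_natCast]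
      have h := ENNReal.ofReal_le_ofReal hreal
      rw [ENNReal.ofReal_mul (Nat.cast_nonneg _), ENNReal.ofReal_natCast,
        ENNReal.ofReal_add (by positivity) (by positivity), hcast _ _ (by positivity),
        hcast _ _ (by positivity)] at h
      rw [Set.indicator_of_mem hbad, Pi.one_apply, one_mul]
      -- Enlarging the range of `m` makes it independent of `k`, so that the two sums can be
      -- exchanged.
      refine h.trans (add_le_add_left (Finset.sum_le_sum_of_subset fun m hm => ?_) _)
      exact Finset.mem_range.2 (Finset.mem_Ico.1 hm).2
    · rw [Set.indicator_of_notMem hbad, zero_mul, mul_zero]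
      exact zero_le
  -- For `m > N` the terms with `k > N` of the moment identity are dropped; for `m < N` the extra
  -- terms vanish with the binomial coefficient.
  have hsum : ∀ m, ∑ k ∈ Finset.range (N + 1), M m k ≤ 1 := by
    intro m
    rw [← hmom m]
    refine Finset.sum_le_sum_of_ne_zero fun k _ hk => ?_
    rw [Finset.mem_range]
    by_contra hkm
    exact hk (by simp [hM, Nat.choose_eq_zero_of_lt (by omega : m < k)])
  refine (Finset.sum_le_sum hbound).trans ?_
  rw [Finset.sum_add_distrib, Finset.sum_comm, Finset.sum_comm (t := Finset.Icc _ _)]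
  simp only [← Finset.mul_sum]
  -- There are `N` sizes below `N` and `3 * N` above, so each group contributes `δ / 2`.
  calc _ ≤ ENNReal.ofReal (δ / (2 * N)) * ∑ m ∈ Finset.range N, 1 +
        ENNReal.ofReal (δ / (6 * N)) * ∑ m ∈ Finset.Icc (N + 1) (4 * N), 1 := by
        gcongr <;> exact hsum _
    _ = ENNReal.ofReal δ := by
        rw [Finset.sum_const, Finset.sum_const, Finset.card_range, Nat.card_Icc, nsmul_one,
          nsmul_one, ← ENNReal.ofReal_natCast, ← ENNReal.ofReal_natCast,
          ← ENNReal.ofReal_mul (by positivity), ← ENNReal.ofReal_mul (by positivity),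
          ← ENNReal.ofReal_add (by positivity) (by positivity)]
        congr 1
        rw [show 4 * N + 1 - (N + 1) = 3 * N by omega]
        push_cast
        field_simp
        norm_num

end Duality

/-! ### Laws of the active set and of the risk. -/

section Probability

open ENNReal

variable {X H : Type*} [NormedAddCommGroup H] [InnerProductSpace ℝ H] [MeasurableSpace X]
  {ι κ : Type*} [Fintype ι] [Fintype κ] {φ : X → H} {ρ t : ℝ}
  {D : Measure (X × ℝ)}

/-- The probability that a fresh example is well inside the tube trained on `u`. -/
noncomputable def insideProb (φ : X → H) (ρ t : ℝ) (D : Measure (X × ℝ)) (u : ι → X × ℝ) : ℝ :=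
  D.real {z | |z.2 - algorithm φ ρ t (sample u) z.1| < t}

lemma insideProb_mem_Icc [IsProbabilityMeasure D] (u : ι → X × ℝ) :
    insideProb φ ρ t D u ∈ Set.Icc (0 : ℝ) 1 :=
  ⟨measureReal_nonneg, measureReal_le_one⟩

lemma measurable_algorithm_sample [CompleteSpace H] (hρ : 0 < ρ)
    (hφ : Measurable fun q : X × X => inner ℝ (φ q.1) (φ q.2)) (u : ι → X × ℝ) :
    Measurable (algorithm φ ρ t (sample u)) :=
  (measurable_algorithm hρ hφ).comp (measurable_const.prodMk measurable_id)

lemma measurable_residual [CompleteSpace H] (hρ : 0 < ρ)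
    (hφ : Measurable fun q : X × X => inner ℝ (φ q.1) (φ q.2)) :
    Measurable fun q : (ι → X × ℝ) × (X × ℝ) =>
      |q.2.2 - algorithm φ ρ t (sample q.1) q.2.1| := by
  have h := measurable_algorithm (ι := ι) (t := t) hρ hφ
  have h : Measurable fun q : (ι → X × ℝ) × (X × ℝ) => algorithm φ ρ t (sample q.1) q.2.1 :=
    h.comp (measurable_fst.prodMk measurable_snd.fst)
  exact (measurable_snd.snd.sub h).abs

lemma measurable_insideProb [CompleteSpace H] [IsProbabilityMeasure D] (hρ : 0 < ρ)
    (hφ : Measurable fun q : X × X => inner ℝ (φ q.1) (φ q.2)) :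
    Measurable (insideProb φ ρ t D : (ι → X × ℝ) → ℝ) :=
  (measurable_measure_prodMk_left (ν := D)
    (measurableSet_lt (measurable_residual hρ hφ) measurable_const)).ennreal_toReal

lemma measurableSet_active_eq [CompleteSpace H] (hρ : 0 < ρ)
    (hφ : Measurable fun q : X × X => inner ℝ (φ q.1) (φ q.2)) (K : Finset ι) :
    MeasurableSet {z : ι → X × ℝ | active φ ρ t z = K} := by
  have : {z : ι → X × ℝ | active φ ρ t z = K} =
      ⋂ i, {z | t ≤ |(z i).2 - algorithm φ ρ t (sample z) (z i).1| ↔ i ∈ K} := by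
    ext z
    simp [Finset.ext_iff, mem_active]
  rw [this]
  refine MeasurableSet.iInter fun i => MeasurableSet.iff ?_ (MeasurableSet.const _)
  exact measurableSet_le measurable_const
    ((measurable_residual hρ hφ).comp (measurable_id.prodMk (measurable_pi_apply i)))

/-- The law of `insideProb` on the event that all the examples are active. -/
noncomputable def insideLaw (φ : X → H) (ρ t : ℝ) (D : Measure (X × ℝ)) (ι : Type*) [Fintype ι] :
    Measure ℝ :=
  ((Measure.pi fun _ : ι => D).restrict {u | active φ ρ t u = Finset.univ}).map
    (insideProb φ ρ t D)

lemma insideLaw_ae_mem_Icc [IsProbabilityMeasure D] [CompleteSpace H] (hρ : 0 < ρ)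
    (hφ : Measurable fun q : X × X => inner ℝ (φ q.1) (φ q.2)) :
    ∀ᵐ s ∂insideLaw φ ρ t D ι, s ∈ Set.Icc (0 : ℝ) 1 := by
  rw [insideLaw, ae_map_iff (p := fun s => s ∈ Set.Icc (0 : ℝ) 1)
    (measurable_insideProb hρ hφ).aemeasurable measurableSet_Icc]
  exact Filter.Eventually.of_forall insideProb_mem_Icc

/-- Training ignores the labelling of the examples, so the law for an index set `K` can be replaced
by the one for `Fin K.card`, whatever the full sample size. -/
lemma insideLaw_congr [IsProbabilityMeasure D] [CompleteSpace H] (hρ : 0 < ρ)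
    (hφ : Measurable fun q : X × X => inner ℝ (φ q.1) (φ q.2)) (e : ι ≃ κ) :
    insideLaw φ ρ t D ι = insideLaw φ ρ t D κ := by
  have hmp := measurePreserving_piCongrLeft (fun _ : κ => D) e
  set E := MeasurableEquiv.piCongrLeft (fun _ : κ => X × ℝ) e
  have happ : ∀ (u : ι → X × ℝ) i, E u (e i) = u i := fun u i =>
    Equiv.piCongrLeft_apply_apply (fun _ : κ => X × ℝ) e u i
  have hsample : ∀ u, sample (E u) = sample u := fun u => by
    rw [← sample_comp_equiv e]
    simp only [happ]
  have hpre : E ⁻¹' {u | active φ ρ t u = Finset.univ} =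
      {u | active φ ρ t u = Finset.univ} := by
    ext u
    simp only [Set.mem_preimage, Set.mem_ofPred_eq, Finset.eq_univ_iff_forall, mem_active, hsample]
    rw [← e.forall_congr_right]
    simp only [happ]
  rw [insideLaw, insideLaw, ← hmp.map_eq,
    Measure.restrict_map hmp.measurable (measurableSet_active_eq hρ hφ _), hpre,
    Measure.map_map (measurable_insideProb hρ hφ) hmp.measurable]
  congr 1
  ext u
  simp only [Function.comp_apply, insideProb, hsample]

/-- Fubini for the splitting into `K` and its complement: given the examples in `K`, the others are
independent and each falls strictly inside the tube with probability `s`, which gives the power of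
`s`. -/
lemma setLIntegral_active_eq [IsProbabilityMeasure D] [CompleteSpace H] [DecidableEq ι] (hρ : 0 < ρ)
    (hφ : Measurable fun q : X × X => inner ℝ (φ q.1) (φ q.2)) (K : Finset ι) {g : ℝ → ℝ≥0∞}
    (hg : Measurable g) :
    ∫⁻ z in {z | active φ ρ t z = K}, g (insideProb φ ρ t D z) ∂(Measure.pi fun _ : ι => D) =
      ∫⁻ s, g s * ENNReal.ofReal (s ^ (Fintype.card ι - K.card)) ∂insideLaw φ ρ t D K := by
  set E := MeasurableEquiv.piEquivPiSubtypeProd (fun _ : ι => X × ℝ) (· ∈ K)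
  have hmp : MeasurePreserving E (Measure.pi fun _ : ι => D)
      ((Measure.pi fun _ : {i // i ∈ K} => D).prod (Measure.pi fun _ : {i // i ∉ K} => D)) := by
    convert measurePreserving_piEquivPiSubtypeProd (fun _ : ι => D) (· ∈ K)
  let A : ({i // i ∈ K} → X × ℝ) → Set (X × ℝ) := fun u =>
    {z | |z.2 - algorithm φ ρ t (sample u) z.1| < t}
  let F : ({i // i ∈ K} → X × ℝ) → ℝ≥0∞ :=
    {u | active φ ρ t u = Finset.univ}.indicator fun u => g (insideProb φ ρ t D u)
  have hF : Measurable F := (hg.comp (measurable_insideProb hρ hφ)).indicator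
    (measurableSet_active_eq hρ hφ _)
  let G : ({i // i ∈ K} → X × ℝ) × ({i // i ∉ K} → X × ℝ) → ℝ≥0∞ := fun q =>
    F q.1 * {q : ({i // i ∈ K} → X × ℝ) × ({i // i ∉ K} → X × ℝ) |
      ∀ i, q.2 i ∈ A q.1}.indicator 1 q
  have hAset : MeasurableSet {q : ({i // i ∈ K} → X × ℝ) × ({i // i ∉ K} → X × ℝ) |
      ∀ i, q.2 i ∈ A q.1} := by
    rw [Set.ofPred_forall]
    exact MeasurableSet.iInter fun i => measurableSet_lt ((measurable_residual hρ hφ).comp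
      (measurable_fst.prodMk ((measurable_pi_apply i).comp measurable_snd))) measurable_const
  have hG : Measurable G := (hF.comp measurable_fst).mul (measurable_one.indicator hAset)
  have hpoint : ∀ z, {z | active φ ρ t z = K}.indicator (fun z => g (insideProb φ ρ t D z)) z =
      G (E z) := by
    intro z
    have hiff := active_eq_iff (φ := φ) (t := t) hρ z K
    by_cases hz : active φ ρ t z = K
    · have hs := solution_eq_of_active_eq hρ hz
      obtain ⟨h1, h2⟩ := hiff.1 hz
      have h1' : (E z).1 ∈ {u : {i // i ∈ K} → X × ℝ | active φ ρ t u = Finset.univ} := h1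
      have h2' : E z ∈ {q : ({i // i ∈ K} → X × ℝ) × ({i // i ∉ K} → X × ℝ) |
        ∀ i, q.2 i ∈ A q.1} := h2
      simp only [G, F]
      rw [Set.indicator_of_mem h1', Set.indicator_of_mem h2',
        Set.indicator_of_mem (show z ∈ {z | active φ ρ t z = K} from hz), Pi.one_apply, mul_one]
      have : insideProb φ ρ t D z = insideProb φ ρ t D (E z).1 := by
        unfold insideProb algorithm
        rw [hs]
        rfl
      rw [this]
    · rw [Set.indicator_of_notMem (show z ∉ {z | active φ ρ t z = K} from hz)]
      rw [hiff, not_and_or] at hz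
      rcases hz with hz | hz
      · have h1 : (E z).1 ∉ {u : {i // i ∈ K} → X × ℝ | active φ ρ t u = Finset.univ} := hz
        simp only [G, F]
        rw [Set.indicator_of_notMem h1, zero_mul]
      · have h2 : E z ∉ {q : ({i // i ∈ K} → X × ℝ) × ({i // i ∉ K} → X × ℝ) |
          ∀ i, q.2 i ∈ A q.1} := hz
        simp only [G]
        rw [Set.indicator_of_notMem h2, mul_zero]
  have hinner : ∀ u, ∫⁻ v, G (u, v) ∂(Measure.pi fun _ : {i // i ∉ K} => D) =
      F u * ENNReal.ofReal (insideProb φ ρ t D u ^ (Fintype.card ι - K.card)) := by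
    intro u
    have h1 : ∀ v, G (u, v) = F u * (Set.univ.pi fun _ : {i // i ∉ K} => A u).indicator 1 v := by
      intro v
      simp only [G]
      congr 1
      by_cases hv : ∀ i, v i ∈ A u
      · rw [Set.indicator_of_mem (Set.mem_univ_pi.2 hv)]
        exact Set.indicator_of_mem (show (u, v) ∈ {q : ({i // i ∈ K} → X × ℝ) ×
          ({i // i ∉ K} → X × ℝ) | ∀ i, q.2 i ∈ A q.1} from hv) _
      · rw [Set.indicator_of_notMem (fun h => hv (Set.mem_univ_pi.1 h))]
        exact Set.indicator_of_notMem (show (u, v) ∉ {q : ({i // i ∈ K} → X × ℝ) ×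
          ({i // i ∉ K} → X × ℝ) | ∀ i, q.2 i ∈ A q.1} from hv) _
    have hAu : MeasurableSet (A u) := measurableSet_lt
      ((measurable_residual hρ hφ).comp (measurable_const.prodMk measurable_id)) measurable_const
    have hpi : MeasurableSet (Set.univ.pi fun _ : {i // i ∉ K} => A u) :=
      MeasurableSet.univ_pi fun _ => hAu
    simp only [h1]
    rw [lintegral_const_mul _ (measurable_one.indicator hpi), lintegral_indicator_one hpi,
      Measure.pi_pi, Finset.prod_const, Finset.card_univ, Fintype.card_subtype_compl,
      Fintype.card_coe, ENNReal.ofReal_pow (insideProb_mem_Icc u).1, insideProb, ofReal_measureReal]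
  rw [← lintegral_indicator (measurableSet_active_eq hρ hφ K)]
  simp only [hpoint]
  rw [hmp.lintegral_comp hG, lintegral_prod _ hG.aemeasurable]
  simp only [hinner]
  rw [insideLaw, lintegral_map (by fun_prop) (measurable_insideProb hρ hφ),
    ← lintegral_indicator (measurableSet_active_eq hρ hφ _)]
  refine lintegral_congr fun u => ?_
  simp only [F, Set.indicator_apply]
  split_ifs <;> simp

omit [MeasurableSpace X] in
lemma apply_active_eq_sum {β : Type*} (g : ℕ → β → ℝ≥0∞) (f : (ι → X × ℝ) → β) (z : ι → X × ℝ) :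
    g (active φ ρ t z).card (f z) =
      ∑ K : Finset ι, {z | active φ ρ t z = K}.indicator (fun z => g K.card (f z)) z := by
  rw [Finset.sum_eq_single (active φ ρ t z)]
  · rw [Set.indicator_of_mem (show z ∈ {y | active φ ρ t y = active φ ρ t z} from rfl)]
  · intro K _ hK
    exact Set.indicator_of_notMem (show z ∉ {y | active φ ρ t y = K} from fun h => hK h.symm) _
  · exact fun h => absurd (Finset.mem_univ _) h

lemma measurable_indicator_active [IsProbabilityMeasure D] [CompleteSpace H] (hρ : 0 < ρ)
    (hφ : Measurable fun q : X × X => inner ℝ (φ q.1) (φ q.2)) {g : ℝ → ℝ≥0∞}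
    (hg : Measurable g) (K : Finset ι) :
    Measurable ({z | active φ ρ t z = K}.indicator fun z => g (insideProb φ ρ t D z)) :=
  (hg.comp (measurable_insideProb hρ hφ)).indicator (measurableSet_active_eq hρ hφ K)

/-- Integration over the samples of size `m`, by the number of active examples. -/
lemma lintegral_active [IsProbabilityMeasure D] [CompleteSpace H] (hρ : 0 < ρ)
    (hφ : Measurable fun q : X × X => inner ℝ (φ q.1) (φ q.2)) (m : ℕ) {g : ℕ → ℝ → ℝ≥0∞}
    (hg : ∀ k, Measurable (g k)) :
    ∫⁻ z, g (active φ ρ t z).card (insideProb φ ρ t D z) ∂(Measure.pi fun _ : Fin m => D) =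
      ∑ k ∈ Finset.range (m + 1), (m.choose k : ℝ≥0∞) *
        ∫⁻ s, g k s * ENNReal.ofReal (s ^ (m - k)) ∂insideLaw φ ρ t D (Fin k) := by
  simp only [apply_active_eq_sum g]
  rw [lintegral_finsetSum _ fun K _ => measurable_indicator_active hρ hφ (hg _) K]
  have h2 : ∀ K : Finset (Fin m), ∫⁻ z, {z | active φ ρ t z = K}.indicator
      (fun z => g K.card (insideProb φ ρ t D z)) z ∂(Measure.pi fun _ : Fin m => D) =
      ∫⁻ s, g K.card s * ENNReal.ofReal (s ^ (m - K.card)) ∂insideLaw φ ρ t D (Fin K.card) := by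
    intro K
    rw [lintegral_indicator (measurableSet_active_eq hρ hφ K),
      setLIntegral_active_eq hρ hφ K (hg _), Fintype.card_fin,
      insideLaw_congr hρ hφ K.equivFin]
  simp only [h2]
  -- The contribution of `K` depends on its cardinality only; grouping the subsets by size yields
  -- the binomial coefficients.
  have h3 := Finset.sum_powerset_apply_card (x := (Finset.univ : Finset (Fin m)))
    fun k => ∫⁻ s, g k s * ENNReal.ofReal (s ^ (m - k)) ∂insideLaw φ ρ t D (Fin k)
  rw [Finset.powerset_univ, Finset.card_univ, Fintype.card_fin] at h3
  simpa only [nsmul_eq_mul] using h3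

/-- Under a conditional law without atoms, no fixed measurable function meets the label. -/
lemma measure_residual_eq_zero [IsProbabilityMeasure D] (hD : ∀ᵐ x ∂D.fst, ∀ y : ℝ, D.condKernel x {y} = 0) {h : X → ℝ}
    (hh : Measurable h) (t : ℝ) : D {z | |z.2 - h z.1| = t} = 0 := by
  have hset : MeasurableSet {z : X × ℝ | |z.2 - h z.1| = t} :=
    measurableSet_eq_fun (measurable_snd.sub (hh.comp measurable_fst)).abs measurable_const
  rw [← D.disintegrate D.condKernel, Measure.compProd_apply hset]
  refine (lintegral_eq_zero_iff' ?_).2 (hD.mono fun x hx => ?_)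
  · exact (Kernel.measurable_kernel_prodMk_left hset).aemeasurable
  · refine measure_mono_null (t := {h x + t} ∪ {h x - t}) (fun y hy => ?_)
      (measure_union_null (hx _) (hx _))
    have hy : |y - h x| = t := hy
    rcases abs_eq (hy ▸ abs_nonneg _) |>.1 hy with h' | h'
    · exact Or.inl (by rw [Set.mem_singleton_iff]; linarith)
    · exact Or.inr (by rw [Set.mem_singleton_iff]; linarith)

/-- The event in the risk and the complement of the inside event differ by residuals equal to `t`, a
null set in the absence of atoms. -/
lemma risk_eq [IsProbabilityMeasure D] [CompleteSpace H] (hρ : 0 < ρ)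
    (hφ : Measurable fun q : X × X => inner ℝ (φ q.1) (φ q.2))
    (hD : ∀ᵐ x ∂D.fst, ∀ y : ℝ, D.condKernel x {y} = 0) (u : ι → X × ℝ) :
    risk D t (algorithm φ ρ t (sample u)) = 1 - insideProb φ ρ t D u := by
  have hres : Measurable fun z : X × ℝ => |z.2 - algorithm φ ρ t (sample u) z.1| :=
    (measurable_residual hρ hφ).comp (measurable_const.prodMk measurable_id)
  rw [insideProb, ← probReal_compl_eq_one_sub (measurableSet_lt hres measurable_const), risk]
  refine measureReal_congr ?_
  have hnull := measure_eq_zero_iff_ae_notMem.1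
    (measure_residual_eq_zero hD (measurable_algorithm_sample (t := t) hρ hφ u) t)
  refine hnull.mono fun z hz => propext ?_
  change t < |z.2 - algorithm φ ρ t (sample u) z.1| ↔
    ¬ |z.2 - algorithm φ ρ t (sample u) z.1| < t
  rw [not_lt]
  exact ⟨le_of_lt, fun h => lt_of_le_of_ne h (Ne.symm hz)⟩

/-- Almost surely no example is on the boundary of the tube trained on the other examples. -/
lemma ae_residual_ne [IsProbabilityMeasure D] [CompleteSpace H] [DecidableEq ι] (hρ : 0 < ρ)
    (hφ : Measurable fun q : X × X => inner ℝ (φ q.1) (φ q.2))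
    (hD : ∀ᵐ x ∂D.fst, ∀ y : ℝ, D.condKernel x {y} = 0) :
    ∀ᵐ z ∂(Measure.pi fun _ : ι => D), ∀ j, |(z j).2 -
      algorithm φ ρ t (sample fun i : {i // i ≠ j} => z i) (z j).1| ≠ t := by
  rw [ae_all_iff]
  intro j
  -- Once the other examples are frozen, their predictor is a fixed measurable function, and example
  -- `j` is independent of it.
  have hmp := measurePreserving_piEquivPiSubtypeProd (fun _ : ι => D) (· ≠ j)
  let j' : {i // ¬ i ≠ j} := ⟨j, not_not.2 rfl⟩
  have hset : MeasurableSet {q : ({i // i ≠ j} → X × ℝ) × ({i // ¬ i ≠ j} → X × ℝ) |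
      |(q.2 j').2 - algorithm φ ρ t (sample q.1) (q.2 j').1| ≠ t} :=
    (measurableSet_eq_fun ((measurable_residual hρ hφ).comp
      (measurable_fst.prodMk ((measurable_pi_apply j').comp measurable_snd)))
      measurable_const).compl
  have hprod : ∀ᵐ q ∂(Measure.pi fun _ : {i // i ≠ j} => D).prod
      (Measure.pi fun _ : {i // ¬ i ≠ j} => D),
      |(q.2 j').2 - algorithm φ ρ t (sample q.1) (q.2 j').1| ≠ t := by
    refine (Measure.ae_prod_iff_ae_ae hset).2 (Filter.Eventually.of_forall fun u => ?_)
    have hnull := measure_eq_zero_iff_ae_notMem.1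
      (measure_residual_eq_zero hD (measurable_algorithm_sample (t := t) hρ hφ u) t)
    have heval := (measurePreserving_eval (fun _ : {i // ¬ i ≠ j} => D)
      j').quasiMeasurePreserving.ae hnull
    exact heval.mono fun v hv => hv
  have hae := hmp.quasiMeasurePreserving.ae hprod
  exact hae.mono fun z hz => hz

/-- The bound for the number of active examples under the product law. -/
lemma measure_active_compl_le [IsProbabilityMeasure D] [CompleteSpace H] (hρ : 0 < ρ)
    (hφ : Measurable fun q : X × X => inner ℝ (φ q.1) (φ q.2)) {N : ℕ} (hN : 1 ≤ N) {δ : ℝ}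
    (hδ : 0 < δ) :
    (Measure.pi fun _ : Fin N => D) {z | ¬ (epsLower N δ (active φ ρ t z).card ≤
        1 - insideProb φ ρ t D z ∧
      1 - insideProb φ ρ t D z ≤ epsUpper N δ (active φ ρ t z).card)} ≤ ENNReal.ofReal δ := by
  let B : ℕ → Set ℝ := fun k => {s | epsLower N δ k ≤ 1 - s ∧ 1 - s ≤ epsUpper N δ k}ᶜ
  have hB : ∀ k, MeasurableSet (B k) := fun k =>
    ((measurableSet_le measurable_const (measurable_const.sub measurable_id)).inter
      (measurableSet_le (measurable_const.sub measurable_id) measurable_const)).compl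
  have hg : ∀ k, Measurable ((B k).indicator (1 : ℝ → ℝ≥0∞)) := fun k =>
    measurable_one.indicator (hB k)
  have hmom : ∀ m, ∑ k ∈ Finset.range (m + 1), (m.choose k : ℝ≥0∞) *
      ∫⁻ s, ENNReal.ofReal (s ^ (m - k)) ∂insideLaw φ ρ t D (Fin k) = 1 := by
    intro m
    -- Integrating the constant `1` over samples of size `m` yields the moment identity.
    have := lintegral_active (D := D) (t := t) hρ hφ m (g := fun _ _ => 1)
      fun _ => measurable_const
    simp only [one_mul, lintegral_const, measure_univ] at this
    exact this.symm
  refine le_trans ?_ (sum_lintegral_compl_le hN hδ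
    (fun k => insideLaw_ae_mem_Icc (ι := Fin k) (D := D) (t := t) hρ hφ) hmom)
  rw [← lintegral_active hρ hφ N hg]
  refine (meas_le_lintegral₀ ?_ fun z hz => ?_)
  · simp only [apply_active_eq_sum fun k => (B k).indicator (1 : ℝ → ℝ≥0∞)]
    exact (Finset.measurable_sum _ fun K _ =>
      measurable_indicator_active hρ hφ (hg _) K).aemeasurable
  · exact (Set.indicator_of_mem (s := B _) hz 1).ge

end Probability

end SVR

theorem mainTheorem10 {X H Ω : Type*} [MeasurableSpace X] [LinearOrder X]
    [NormedAddCommGroup H] [InnerProductSpace ℝ H] [CompleteSpace H]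
    [MeasurableSpace Ω] (P : Measure Ω) [IsProbabilityMeasure P]
    (φ : X → H) (hφ : Measurable fun q : X × X => inner ℝ (φ q.1) (φ q.2))
    (ρ t : ℝ) (hρ : 0 < ρ) (ht : 0 ≤ t)
    (D : Measure (X × ℝ)) [IsProbabilityMeasure D]
    (hD : ∀ᵐ x ∂D.fst, ∀ y : ℝ, D.condKernel x {y} = 0)
    (N : ℕ) (hN : 1 ≤ N)
    (z : Fin N → Ω → X × ℝ) (hz : ∀ i, Measurable (z i))
    (hlaw : ∀ i, P.map (z i) = D) (hindep : iIndepFun z P)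
    (δ : ℝ) (hδ0 : 0 < δ) (hδ1 : δ < 1) :
    1 - δ ≤ P.real {ω |
      SVR.epsLower N δ (SVR.compression φ ρ t (SVR.trainingSet fun i => z i ω)).card ≤
          SVR.risk D t (SVR.algorithm φ ρ t (SVR.trainingSet fun i => z i ω)) ∧
        SVR.risk D t (SVR.algorithm φ ρ t (SVR.trainingSet fun i => z i ω)) ≤
          SVR.epsUpper N δ (SVR.compression φ ρ t (SVR.trainingSet fun i => z i ω)).card} := by
  have hmap : P.map (fun ω i => z i ω) = Measure.pi fun _ : Fin N => D := by
    rw [(iIndepFun_iff_map_fun_eq_pi_map fun i => (hz i).aemeasurable).1 hindep]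
    simp only [hlaw]
  have hmp : MeasurePreserving (fun ω i => z i ω) P (Measure.pi fun _ : Fin N => D) :=
    ⟨measurable_pi_iff.2 hz, hmap⟩
  have hae := hmp.quasiMeasurePreserving.ae
    (SVR.ae_residual_ne (ι := Fin N) (φ := φ) (t := t) hρ hφ hD)
  set G := {ω |
      SVR.epsLower N δ (SVR.compression φ ρ t (SVR.trainingSet fun i => z i ω)).card ≤
          SVR.risk D t (SVR.algorithm φ ρ t (SVR.trainingSet fun i => z i ω)) ∧
        SVR.risk D t (SVR.algorithm φ ρ t (SVR.trainingSet fun i => z i ω)) ≤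
          SVR.epsUpper N δ (SVR.compression φ ρ t (SVR.trainingSet fun i => z i ω)).card}
  have hbad : P Gᶜ ≤ ENNReal.ofReal δ := by
    refine le_trans ?_ (SVR.measure_active_compl_le (D := D) (t := t) hρ hφ hN hδ0)
    rw [← hmap]
    refine le_trans (measure_mono_ae ?_) (Measure.le_map_apply hmp.measurable.aemeasurable _)
    refine hae.mono fun ω hω hG hgood => hG ?_
    change SVR.epsLower N δ (SVR.compression φ ρ t (SVR.sample fun i => z i ω)).card ≤
        SVR.risk D t (SVR.algorithm φ ρ t (SVR.sample fun i => z i ω)) ∧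
      SVR.risk D t (SVR.algorithm φ ρ t (SVR.sample fun i => z i ω)) ≤
        SVR.epsUpper N δ (SVR.compression φ ρ t (SVR.sample fun i => z i ω)).card
    rw [SVR.card_compression_eq hρ _ hω, SVR.risk_eq hρ hφ hD]
    exact hgood
  have hbad' : P.real Gᶜ ≤ δ := ENNReal.toReal_le_of_le_ofReal hδ0.le hbad
  -- Subadditivity replaces the complement rule, so `G` need not be shown measurable.
  have huniv : P.real (G ∪ Gᶜ) ≤ P.real G + P.real Gᶜ := measureReal_union_le _ _
  rw [Set.union_compl_self, probReal_univ] at huniv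
  linarith
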